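/- Let $p>0$ and $\theta\in\mathbb R$ be constants, let $N\ge 1$ be an integer, let $(k_1,\dots,k_N)\in\mathbb R^N$, and put $k(x)=\sum_{n=1}^N k_n\sqrt2\,\sin(n\pi x)$ for $x\in[0,1]$. Write $\|f\|=\left(\int_0^1|f(z)|^2\,dz\right)^{1/2}$ for $f\in L^2(0,1)$ and $u[t]=u(t,\cdot)$. Then there exist constants $Q,\sigma>0$ such that for every $u_0\in L^2(0,1)$ the initial-boundary value problem $$u_t(t,x)=p\,u_{xx}(t,x)+\theta\,u(t,x)\quad (t>0,\ x\in(0,1)),$$ $$u(t,0)=0,\qquad u(t,1)=\int_0^1 k(s)\,u(t,s)\,ds\quad (t>0),\qquad u[0]=u_0 \text{ in } L^2(0,1),$$ has a unique solution $u\in C^0([0,\infty);L^2(0,1))\cap C^1((0,\infty)\times[0,1])$ with $u[t]\in C^2([0,1])$ for all $t>0$, and this solution satisfies $$\|u[t]\|\le Q\,e^{\sigma t}\,\|u_0\|\qquad\text{for all } t\ge 0.$$ -/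

import Mathlib

open MeasureTheory Set

namespace ReactionDiffusion

/-- The space `L²(0,1)` of (equivalence classes of) real square-integrable functions. -/
abbrev L2 : Type := Lp ℝ 2 (volume.restrict (Ioo (0 : ℝ) 1))

/-- The norm `‖f‖ = (∫₀¹ |f(z)|² dz)^{1/2}`, used for square-integrable `f` only. -/
noncomputable def l2Norm (f : ℝ → ℝ) : ℝ :=
  √(∫ z in Ioo (0 : ℝ) 1, |f z| ^ 2)

/-- The functions `φ_n(x) = √2 sin(nπx)`. -/
noncomputable def phi (n : ℕ) (x : ℝ) : ℝ :=
  √2 * Real.sin (n * Real.pi * x)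

/-- The kernel `k(x) = ∑_{n=1}^N k_n φ_n(x)`; the coefficient `k_n` is stored at index `n - 1`. -/
noncomputable def kernel {N : ℕ} (k : Fin N → ℝ) (x : ℝ) : ℝ :=
  ∑ i : Fin N, k i * phi (i.val + 1) x

/-- `u` is a solution, with `u ∈ C⁰(ℝ₊; L²(0,1)) ∩ C¹((0,∞) × [0,1])` and `u[t] ∈ C²([0,1])`
for `t > 0`, of `u_t = p u_xx + θ u` on `(0,∞) × (0,1)` with `u(t,0) = 0`,
`u(t,1) = ∫₀¹ k(s) u(t,s) ds` for `t > 0`, and `u[0] = u₀` in `L²(0,1)`.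
Only the values of `u` on `[0,∞) × [0,1]` are relevant, and `u 0` matters only
almost everywhere. -/
structure IsSolution (p θ : ℝ) (k : ℝ → ℝ) (u₀ : L2) (u : ℝ → ℝ → ℝ) : Prop where
  /-- The profiles `u[t]`, `t ≥ 0`, form a continuous curve in `L²(0,1)` starting at `u₀`. -/
  curve : ∃ U : ℝ → L2, ContinuousOn U (Ici 0) ∧ U 0 = u₀ ∧
    ∀ t, 0 ≤ t → u t =ᵐ[volume.restrict (Ioo (0 : ℝ) 1)] U t
  contDiffOn_one :
    ContDiffOn ℝ 1 (fun q : ℝ × ℝ => u q.1 q.2) (Ioi (0 : ℝ) ×ˢ Icc (0 : ℝ) 1)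
  contDiffOn_two : ∀ t, 0 < t → ContDiffOn ℝ 2 (u t) (Icc (0 : ℝ) 1)
  pde : ∀ t, 0 < t → ∀ x ∈ Ioo (0 : ℝ) 1,
    deriv (fun s => u s x) t = p * iteratedDeriv 2 (u t) x + θ * u t x
  left_bc : ∀ t, 0 < t → u t 0 = 0
  right_bc : ∀ t, 0 < t → u t 1 = ∫ s in (0 : ℝ)..1, k s * u t s

end ReactionDiffusion

namespace ReactionDiffusion

/-! The proof works with the sine coefficients `c_n` of `u[t]`. Integrating by parts twice against
`φ_n` gives `c_n' = λ_n c_n + b_n u(t,1)`, with `λ_n = θ - p n²π²`: only the boundary value at `x =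
1` survives. Since `k` combines the first `N` modes, `u(t,1) = ∑ k_i c_i(t)`, so `c_1, …, c_N` solve
a closed linear system `y' = A y` (`generator`), and the boundary value drives every other
coefficient by a scalar equation.

Uniqueness follows from Grönwall: first for the `N` low coefficients, then, the boundary values
being equal, for each remaining one (`IsSolution.sineCoeff_unique`). Completeness of the sines turns
equality of coefficients into equality of functions.

For existence, solve `y' = A y` by the matrix exponential and let `w = ∑ k_i y_i`, a function with
bounds of the form `C e^{at} ‖u₀‖` on `w`, `w'`, `w''`. Write `u = x w + h m + v`, where `p h'' =
x`, `h(0) = h(1) = 0` and `m = w' - θ w`. Then `v` vanishes at both ends and `v_t = p v_xx + θ v + h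
(θ m - m')`. Lifting by `x w` alone would leave a multiple of `x`, with coefficients of order `1/n`,
too large for the series of `v_xx` to converge absolutely; the term `h m` replaces it by a multiple
of `h`, with coefficients of order `n⁻³`. The Duhamel series for `v` can then be differentiated
termwise at positive times (`regularCoeffs_modeCoeff`).

The first `N` coefficients of this `u` solve the equations that `y` solves, with the same initial
values, so they equal `y` and the nonlocal boundary condition holds (`BoundaryData.fullCoeff_eq_y`).
Parseval gives continuity in `L²` down to `t = 0` and the exponential estimate. -/

/-! ### Sine modes in `L²(0,1)` -/

theorem continuous_phi (n : ℕ) : Continuous (phi n) := by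
  unfold phi; fun_prop

theorem abs_phi_le (n : ℕ) (x : ℝ) : |phi n x| ≤ 2 := by
  unfold phi
  rw [abs_mul, abs_of_nonneg (Real.sqrt_nonneg 2)]
  have h1 : √2 ≤ 2 := Real.sqrt_le_iff.2 ⟨by norm_num, by norm_num⟩
  have h2 := Real.abs_sin_le_one (n * Real.pi * x)
  nlinarith [Real.sqrt_nonneg 2, abs_nonneg (Real.sin (n * Real.pi * x))]

theorem integral_cos_int_mul_pi (j : ℤ) :
    ∫ x in (0 : ℝ)..1, Real.cos (j * Real.pi * x) = if j = 0 then 1 else 0 := by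
  split_ifs with h
  · simp [h]
  · have hj : (j : ℝ) * Real.pi ≠ 0 := mul_ne_zero (by exact_mod_cast h) Real.pi_ne_zero
    rw [intervalIntegral.integral_comp_mul_left (fun x => Real.cos x) hj, integral_cos]
    simp [Real.sin_int_mul_pi]

theorem integral_phi_mul_phi (m n : ℕ) :
    ∫ x in (0 : ℝ)..1, phi (m + 1) x * phi (n + 1) x = if m = n then 1 else 0 := by
  have h : ∀ x : ℝ, phi (m + 1) x * phi (n + 1) x =
      Real.cos (((m : ℤ) - n : ℤ) * Real.pi * x) -
        Real.cos (((m : ℤ) + n + 2 : ℤ) * Real.pi * x) := by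
    intro x
    have e1 : (((m : ℤ) - n : ℤ) : ℝ) * Real.pi * x
        = ((m + 1 : ℕ) : ℝ) * Real.pi * x - ((n + 1 : ℕ) : ℝ) * Real.pi * x := by
      push_cast; ring
    have e2 : (((m : ℤ) + n + 2 : ℤ) : ℝ) * Real.pi * x
        = ((m + 1 : ℕ) : ℝ) * Real.pi * x + ((n + 1 : ℕ) : ℝ) * Real.pi * x := by
      push_cast; ring
    rw [e1, e2, Real.cos_sub, Real.cos_add]
    unfold phi
    have := Real.mul_self_sqrt (show (0 : ℝ) ≤ 2 by norm_num)
    linear_combination (Real.sin (((m + 1 : ℕ) : ℝ) * Real.pi * x) *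
      Real.sin (((n + 1 : ℕ) : ℝ) * Real.pi * x)) * this
  simp_rw [h]
  rw [intervalIntegral.integral_sub (by apply Continuous.intervalIntegrable; fun_prop)
    (by apply Continuous.intervalIntegrable; fun_prop), integral_cos_int_mul_pi,
    integral_cos_int_mul_pi]
  -- The shift to `φ_{m+1}`, `φ_{n+1}` excludes the zero mode, so the sum frequency never vanishes.
  have h2 : ((m : ℤ) + n + 2) ≠ 0 := by positivity
  have h3 : ((m : ℤ) - n = 0) ↔ m = n := by omega
  simp [h2, h3]

theorem setIntegral_Ioo_eq_intervalIntegral (f : ℝ → ℝ) :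
    ∫ x in Ioo (0 : ℝ) 1, f x = ∫ x in (0 : ℝ)..1, f x := by
  rw [intervalIntegral.integral_of_le zero_le_one, integral_Ioc_eq_integral_Ioo]

theorem memLp_of_continuousOn {f : ℝ → ℝ} (hf : ContinuousOn f (Icc 0 1)) :
    MemLp f 2 (volume.restrict (Ioo (0 : ℝ) 1)) := by
  obtain ⟨C, hC⟩ := isCompact_Icc.exists_bound_of_continuousOn hf
  refine MemLp.of_bound
    ((hf.mono Ioo_subset_Icc_self).aestronglyMeasurable measurableSet_Ioo) C ?_
  filter_upwards [ae_restrict_mem measurableSet_Ioo] with x hx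
  exact hC x (Ioo_subset_Icc_self hx)

theorem inner_eq_integral (f g : L2) :
    inner ℝ f g = ∫ x in Ioo (0 : ℝ) 1, f x * g x := by
  rw [L2.inner_def]
  refine integral_congr_ae (Filter.Eventually.of_forall fun x => ?_)
  simp [mul_comm]

/-- The `L²` class of the `n`-th mode `φ_{n+1}`. -/
noncomputable def mode (n : ℕ) : L2 :=
  (memLp_of_continuousOn (continuous_phi (n + 1)).continuousOn).toLp

theorem coeFn_mode (n : ℕ) : mode n =ᵐ[volume.restrict (Ioo (0 : ℝ) 1)] phi (n + 1) :=
  MemLp.coeFn_toLp _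

theorem inner_mode {f : L2} {g : ℝ → ℝ} (h : f =ᵐ[volume.restrict (Ioo (0 : ℝ) 1)] g) (n : ℕ) :
    inner ℝ (mode n) f = ∫ x in (0 : ℝ)..1, phi (n + 1) x * g x := by
  rw [inner_eq_integral, ← setIntegral_Ioo_eq_intervalIntegral]
  refine integral_congr_ae ?_
  filter_upwards [coeFn_mode n, h] with x h1 h2
  rw [h1, h2]

theorem orthonormal_mode : Orthonormal ℝ mode := by
  rw [orthonormal_iff_ite]
  intro i j
  rw [inner_mode (coeFn_mode j), integral_phi_mul_phi]

theorem l2Norm_congr {f g : ℝ → ℝ} (h : f =ᵐ[volume.restrict (Ioo (0 : ℝ) 1)] g) :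
    l2Norm f = l2Norm g := by
  unfold l2Norm
  congr 1
  refine integral_congr_ae ?_
  filter_upwards [h] with x hx
  rw [hx]

theorem l2Norm_coeFn (f : L2) : l2Norm f = ‖f‖ := by
  rw [norm_eq_sqrt_real_inner, inner_eq_integral, l2Norm]
  simp [sq]

/-! ### Completeness of the sine system -/

/-- A square-integrable function on `(0,1)` whose sine coefficients all vanish is zero. -/
theorem ae_eq_zero_of_sine_coeff_eq_zero (f : L2)
    (h : ∀ n : ℕ, ∫ x in Ioo (0 : ℝ) 1, phi (n + 1) x * f x = 0) :
    f =ᵐ[volume.restrict (Ioo (0 : ℝ) 1)] 0 := by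
  set g : ℝ → ℂ := (Ioo (0 : ℝ) 1).indicator (fun x => (f x : ℂ)) with hg
  have hgL : MemLp g 2 volume := by
    rw [hg, memLp_indicator_iff_restrict measurableSet_Ioo]
    exact (Lp.memLp f).ofReal
  have hgL' : MemLp (fun x => g (-x)) 2 volume :=
    hgL.comp_measurePreserving (Measure.measurePreserving_neg volume)
  -- Odd extension of `f` to `(-1,1)`: its Fourier coefficients for period 2 involve only the sine
  -- coefficients of `f`, hence vanish, and Parseval gives `F = 0`.
  set F : ℝ → ℂ := fun x => g x - g (-x) with hF
  have hFL : MemLp F 2 (volume.restrict (Ioc (-1 : ℝ) 1)) := (hgL.sub hgL').restrict _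
  have hab : (-1 : ℝ) < 1 := by norm_num
  have hgI : ∀ e : ℝ → ℂ, Continuous e →
      IntervalIntegrable (fun x => e x * g x) volume (-1) 1 := by
    intro e he
    have : IntervalIntegrable g volume (-1) 1 := by
      rw [intervalIntegrable_iff_integrableOn_Ioc_of_le hab.le]
      exact (hgL.restrict _).integrable (by norm_num)
    exact this.continuousOn_mul he.continuousOn
  have hgI' : ∀ e : ℝ → ℂ, Continuous e →
      IntervalIntegrable (fun x => e x * g (-x)) volume (-1) 1 := by
    intro e he
    have : IntervalIntegrable (fun x => g (-x)) volume (-1) 1 := by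
      rw [intervalIntegrable_iff_integrableOn_Ioc_of_le hab.le]
      exact (hgL'.restrict _).integrable (by norm_num)
    exact this.continuousOn_mul he.continuousOn
  have hsin : ∀ n : ℤ, ∫ x in Ioo (0 : ℝ) 1, Real.sin (n * Real.pi * x) * f x = 0 := by
    have key : ∀ m : ℕ, ∫ x in Ioo (0 : ℝ) 1, Real.sin (m * Real.pi * x) * f x = 0 := by
      intro m
      rcases m with _ | m
      · simp
      · have := h m
        simp only [phi, mul_assoc] at this
        rw [integral_const_mul] at this
        simpa [mul_assoc] using this
    intro n
    obtain ⟨m, rfl | rfl⟩ := n.eq_nat_or_neg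
    · simpa using key m
    · have := key m
      simp only [Int.cast_neg, Int.cast_natCast, neg_mul, Real.sin_neg, integral_neg, this,
        neg_zero]
  have hco : ∀ n : ℤ, fourierCoeffOn hab F n = 0 := by
    intro n
    rw [fourierCoeffOn_eq_integral]
    set e : ℝ → ℂ := fun x => fourier (-n) (x : AddCircle ((1 : ℝ) - -1)) with he
    have hec : Continuous e := by
      have : Continuous (fun x : ℝ => (x : AddCircle ((1 : ℝ) - -1))) :=
        AddCircle.continuous_mk' _
      exact (fourier (-n)).continuous.comp this
    have hee : ∀ x, e x - e (-x) = -2 * Complex.I * (Real.sin (n * Real.pi * x) : ℝ) := by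
      intro x
      simp only [he, fourier_coe_apply]
      rw [Complex.ofReal_sin, Complex.sin]
      push_cast
      have e1 : 2 * (Real.pi : ℂ) * Complex.I * (-(n : ℂ)) * x / (1 - -1)
        = -((n : ℂ) * Real.pi * x) * Complex.I := by ring
      have e2 : 2 * (Real.pi : ℂ) * Complex.I * (-(n : ℂ)) * (-x) / (1 - -1)
        = ((n : ℂ) * Real.pi * x) * Complex.I := by ring
      rw [e1, e2]
      linear_combination (Complex.exp (-((n : ℂ) * Real.pi * x) * Complex.I) -
        Complex.exp (((n : ℂ) * Real.pi * x) * Complex.I)) * Complex.I_mul_I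
    -- Reflecting `x ↦ -x` moves the oddness from `F` to the exponential, whose odd part is a sine.
    have h1 : ∫ x in (-1 : ℝ)..1, e x • F x = ∫ x in (-1 : ℝ)..1, (e x - e (-x)) * g x := by
      have h2 : ∫ x in (-1 : ℝ)..1, e x * g (-x) = ∫ x in (-1 : ℝ)..1, e (-x) * g x := by
        have := intervalIntegral.integral_comp_neg (a := -1) (b := 1) (fun x => e (-x) * g x)
        simpa using this
      simp only [hF, smul_eq_mul, mul_sub, sub_mul]
      rw [intervalIntegral.integral_sub (hgI e hec) (hgI' e hec), h2,
        intervalIntegral.integral_sub (hgI e hec) (hgI (fun x => e (-x)) (hec.comp continuous_neg))]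
    have h3 : ∫ x in (-1 : ℝ)..1, (e x - e (-x)) * g x = 0 := by
      rw [intervalIntegral.integral_of_le hab.le]
      have h4 : ∀ x, (e x - e (-x)) * g x = (Ioo (0 : ℝ) 1).indicator
          (fun x => -2 * Complex.I * ((Real.sin (n * Real.pi * x) * f x : ℝ) : ℂ)) x := by
        intro x
        by_cases hx : x ∈ Ioo (0 : ℝ) 1
        · simp only [hg, indicator_of_mem hx, hee]
          push_cast; ring
        · simp only [hg, indicator_of_notMem hx, mul_zero]
      simp_rw [h4]
      rw [setIntegral_indicator measurableSet_Ioo]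
      have h5 : Ioc (-1 : ℝ) 1 ∩ Ioo 0 1 = Ioo 0 1 :=
        inter_eq_right.2 fun x hx => ⟨by linarith [hx.1], hx.2.le⟩
      rw [h5, integral_const_mul, integral_complex_ofReal, hsin n]
      simp
    rw [h1, h3, smul_zero]
  have hP := (hasSum_sq_fourierCoeffOn hab hFL).tsum_eq
  simp only [hco, norm_zero, ne_eq, OfNat.ofNat_ne_zero, not_false_eq_true, zero_pow,
    tsum_zero] at hP
  have hP' : ∫ x in Ioc (-1 : ℝ) 1, ‖F x‖ ^ 2 = 0 := by
    rw [intervalIntegral.integral_of_le hab.le] at hP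
    norm_num at hP
    exact hP
  rw [integral_eq_zero_iff_of_nonneg (fun x => by positivity)
    (hFL.integrable_norm_pow (by norm_num))] at hP'
  have hP2 := ae_restrict_of_ae_restrict_of_subset
    (show Ioo (0 : ℝ) 1 ⊆ Ioc (-1) 1 from fun x hx => ⟨by linarith [hx.1], hx.2.le⟩) hP'
  filter_upwards [hP2, ae_restrict_mem measurableSet_Ioo] with x hx hxm
  have hx' : -x ∉ Ioo (0 : ℝ) 1 := fun hh => by linarith [hh.1, hxm.1]
  simpa [hF, hg, indicator_of_mem hxm, indicator_of_notMem hx'] using hx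

theorem eq_zero_of_inner_mode_eq_zero (f : L2) (h : ∀ n, inner ℝ (mode n) f = 0) : f = 0 := by
  rw [Lp.eq_zero_iff_ae_eq_zero]
  refine ae_eq_zero_of_sine_coeff_eq_zero f fun n => ?_
  rw [setIntegral_Ioo_eq_intervalIntegral, ← inner_mode (Filter.EventuallyEq.refl _ _), h]

/-- The functions `φ_n` form a Hilbert basis of `L²(0,1)`. -/
noncomputable def sineBasis : HilbertBasis ℕ ℝ L2 :=
  HilbertBasis.mkOfOrthogonalEqBot orthonormal_mode <| by
    rw [Submodule.eq_bot_iff]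
    intro f hf
    refine eq_zero_of_inner_mode_eq_zero f fun n => ?_
    exact (Submodule.mem_orthogonal _ _).1 hf _ (Submodule.subset_span ⟨n, rfl⟩)

theorem sineBasis_apply (n : ℕ) : sineBasis n = mode n := by
  simp [sineBasis]

theorem ext_inner_mode {f g : L2} (h : ∀ n, inner ℝ (mode n) f = inner ℝ (mode n) g) :
    f = g := by
  rw [← sub_eq_zero]
  refine eq_zero_of_inner_mode_eq_zero _ fun n => ?_
  rw [inner_sub_right, h, sub_self]

theorem hasSum_sq_inner_mode (f : L2) : HasSum (fun n => inner ℝ (mode n) f ^ 2) (‖f‖ ^ 2) := by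
  have := sineBasis.hasSum_inner_mul_inner f f
  rw [real_inner_self_eq_norm_sq] at this
  simp only [sineBasis_apply, real_inner_comm _ f, ← sq] at this
  exact this

theorem exists_inner_mode_eq {c : ℕ → ℝ} (hc : Summable fun n => c n ^ 2) :
    ∃ f : L2, ∀ n, inner ℝ (mode n) f = c n := by
  have hm : Memℓp c 2 := by
    rw [memℓp_gen_iff (by norm_num)]
    simpa using hc
  refine ⟨sineBasis.repr.symm ⟨c, hm⟩, fun n => ?_⟩
  rw [← sineBasis_apply, ← HilbertBasis.repr_apply_apply]
  simp

theorem abs_inner_mode_le (n : ℕ) (f : L2) : |inner ℝ (mode n) f| ≤ ‖f‖ := by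
  have := abs_real_inner_le_norm (mode n) f
  rwa [orthonormal_mode.1 n, one_mul] at this

/-! ### Evolution of the sine coefficients of a solution -/

/-- The eigenvalue `θ - p (n+1)² π²` of `p ∂ₓₓ + θ` belonging to `φ_{n+1}`. -/
noncomputable def eigenvalue (p θ : ℝ) (n : ℕ) : ℝ :=
  θ - p * ((n + 1) * Real.pi) ^ 2

/-- The coefficient with which the boundary value at `x = 1` enters the evolution of the
sine coefficient of index `n + 1`. -/
noncomputable def boundaryCoeff (p : ℝ) (n : ℕ) : ℝ :=
  p * (√2 * ((n + 1) * Real.pi) * (-1) ^ n)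

/-- The sine coefficient of index `n + 1`. -/
noncomputable def sineCoeff (f : ℝ → ℝ) (n : ℕ) : ℝ :=
  ∫ x in (0 : ℝ)..1, phi (n + 1) x * f x

/-- The derivative of `φ_n`. -/
noncomputable def phiDeriv (n : ℕ) (x : ℝ) : ℝ :=
  √2 * (n * Real.pi) * Real.cos (n * Real.pi * x)

theorem hasDerivAt_phi (n : ℕ) (x : ℝ) : HasDerivAt (phi n) (phiDeriv n x) x := by
  have h : HasDerivAt (fun x : ℝ => n * Real.pi * x) (n * Real.pi) x := by
    simpa using (hasDerivAt_id x).const_mul (n * Real.pi : ℝ)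
  refine (h.sin.const_mul √2).congr_deriv ?_
  unfold phiDeriv; ring

theorem hasDerivAt_phiDeriv (n : ℕ) (x : ℝ) :
    HasDerivAt (phiDeriv n) (-(n * Real.pi) ^ 2 * phi n x) x := by
  have h : HasDerivAt (fun x : ℝ => n * Real.pi * x) (n * Real.pi) x := by
    simpa using (hasDerivAt_id x).const_mul (n * Real.pi : ℝ)
  refine (h.cos.const_mul (√2 * (n * Real.pi))).congr_deriv ?_
  unfold phi; ring

theorem continuous_phiDeriv (n : ℕ) : Continuous (phiDeriv n) := by
  unfold phiDeriv; fun_prop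

theorem phi_zero_right (n : ℕ) : phi n 0 = 0 := by simp [phi]

theorem phi_one_right (n : ℕ) : phi n 1 = 0 := by simp [phi, Real.sin_nat_mul_pi]

theorem phiDeriv_one_right (n : ℕ) :
    phiDeriv (n + 1) 1 = -(√2 * ((n + 1) * Real.pi) * (-1) ^ n) := by
  unfold phiDeriv
  rw [mul_one, Real.cos_nat_mul_pi]
  push_cast; ring

/-- Two integrations by parts. The boundary terms with `g'` vanish because `φ` is zero at both ends,
the one at `0` because `g 0 = 0`; what remains is `-φ'(1) g(1)`. The integrability clause allows the
integral of the differential equation to be split. -/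
theorem integral_phi_mul_iteratedDeriv_two {g : ℝ → ℝ} (hg : ContDiffOn ℝ 2 g (Icc 0 1))
    (h0 : g 0 = 0) (n : ℕ) :
    IntervalIntegrable (fun x => phi (n + 1) x * iteratedDeriv 2 g x) volume 0 1 ∧
    ∫ x in (0 : ℝ)..1, phi (n + 1) x * iteratedDeriv 2 g x =
      -((n + 1) * Real.pi) ^ 2 * sineCoeff g n + √2 * ((n + 1) * Real.pi) * (-1) ^ n * g 1 := by
  have hu : UniqueDiffOn ℝ (Icc (0 : ℝ) 1) := uniqueDiffOn_Icc zero_lt_one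
  set g1 := derivWithin g (Icc 0 1) with hg1
  set g2 := derivWithin g1 (Icc 0 1) with hg2
  have hg1c : ContDiffOn ℝ 1 g1 (Icc 0 1) := hg.derivWithin hu (by norm_num)
  have hg2c : ContinuousOn g2 (Icc 0 1) := hg1c.continuousOn_derivWithin hu le_rfl
  have hd : ∀ x ∈ Ioo (0 : ℝ) 1, HasDerivAt g (g1 x) x := fun x hx =>
    ((hg.differentiableOn (by norm_num)) x (Ioo_subset_Icc_self hx)).hasDerivWithinAt.hasDerivAt
      (Icc_mem_nhds hx.1 hx.2)
  have hd1 : ∀ x ∈ Ioo (0 : ℝ) 1, HasDerivAt g1 (g2 x) x := fun x hx =>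
    ((hg1c.differentiableOn (by norm_num)) x (Ioo_subset_Icc_self hx)).hasDerivWithinAt.hasDerivAt
      (Icc_mem_nhds hx.1 hx.2)
  -- `iteratedDeriv` is two-sided and may differ from the one-sided derivative at the endpoints, a
  -- null set.
  have hit : ∀ x ∈ Ioo (0 : ℝ) 1, iteratedDeriv 2 g x = g2 x := by
    intro x hx
    rw [iteratedDeriv_succ, iteratedDeriv_one]
    refine HasDerivAt.deriv ((hd1 x hx).congr_of_eventuallyEq ?_)
    filter_upwards [isOpen_Ioo.mem_nhds hx] with y hy
    exact (hd y hy).deriv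
  have hphi := continuous_phi (n + 1)
  have hI2 : IntervalIntegrable (fun x => phi (n + 1) x * g2 x) volume 0 1 := by
    apply ContinuousOn.intervalIntegrable
    rw [uIcc_of_le zero_le_one]
    exact hphi.continuousOn.mul hg2c
  have hI0 : IntervalIntegrable (fun x => phi (n + 1) x * g x) volume 0 1 := by
    apply ContinuousOn.intervalIntegrable
    rw [uIcc_of_le zero_le_one]
    exact hphi.continuousOn.mul hg.continuousOn
  have hae : EqOn (fun x => phi (n + 1) x * g2 x)
      (fun x => phi (n + 1) x * iteratedDeriv 2 g x) (Ioo 0 1) := by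
    intro x hx
    simp only [hit x hx]
  have hF := intervalIntegral.integral_eq_sub_of_hasDerivAt_of_le zero_le_one
    (f := fun x => phi (n + 1) x * g1 x - phiDeriv (n + 1) x * g x)
    (f' := fun x => phi (n + 1) x * g2 x + ((n + 1) * Real.pi) ^ 2 * (phi (n + 1) x * g x))
    ((hphi.continuousOn.mul hg1c.continuousOn).sub
      ((continuous_phiDeriv _).continuousOn.mul hg.continuousOn))
    (fun x hx => by
      refine (((hasDerivAt_phi (n + 1) x).mul (hd1 x hx)).sub
        ((hasDerivAt_phiDeriv (n + 1) x).mul (hd x hx))).congr_deriv ?_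
      push_cast; ring)
    (hI2.add (hI0.const_mul _))
  rw [intervalIntegral.integral_add hI2 (hI0.const_mul _),
    intervalIntegral.integral_const_mul, phi_one_right, phi_zero_right, h0,
    phiDeriv_one_right] at hF
  constructor
  · refine hI2.congr_ae ?_
    rw [uIoc_of_le zero_le_one, ← restrict_Ioo_eq_restrict_Ioc]
    filter_upwards [ae_restrict_mem measurableSet_Ioo] with x hx using hae hx
  · rw [← setIntegral_Ioo_eq_intervalIntegral, ← setIntegral_congr_fun measurableSet_Ioo hae,
      setIntegral_Ioo_eq_intervalIntegral]
    unfold sineCoeff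
    linear_combination hF

/-- Regularity up to `x = 0` and `x = 1` makes the time derivative bounded on `[t/2, 2t] × [0,1]`,
which justifies differentiation under the integral. -/
theorem hasDerivAt_integral_phi_mul {u : ℝ → ℝ → ℝ}
    (hu : ContDiffOn ℝ 1 (fun q : ℝ × ℝ => u q.1 q.2) (Ioi (0 : ℝ) ×ˢ Icc (0 : ℝ) 1))
    (n : ℕ) {t : ℝ} (ht : 0 < t) :
    HasDerivAt (fun s => sineCoeff (u s) n)
      (∫ x in (0 : ℝ)..1, phi (n + 1) x * deriv (fun s => u s x) t) t := by
  set S : Set (ℝ × ℝ) := Ioi (0 : ℝ) ×ˢ Icc (0 : ℝ) 1 with hS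
  have hSu : UniqueDiffOn ℝ S := (isOpen_Ioi.uniqueDiffOn).prod (uniqueDiffOn_Icc zero_lt_one)
  set D : ℝ × ℝ → ℝ := fun q =>
    fderivWithin ℝ (fun q : ℝ × ℝ => u q.1 q.2) S q ((1 : ℝ), (0 : ℝ)) with hD
  have hDc : ContinuousOn D S :=
    (hu.continuousOn_fderivWithin hSu le_rfl).clm_apply continuousOn_const
  have huD : ∀ s, 0 < s → ∀ x ∈ Ioo (0 : ℝ) 1, HasDerivAt (fun s => u s x) (D (s, x)) s := by
    intro s hs x hx
    have hmem : S ∈ nhds (s, x) :=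
      prod_mem_nhds (Ioi_mem_nhds hs) (Icc_mem_nhds hx.1 hx.2)
    have h1 := ((hu.differentiableOn (by norm_num)) (s, x)
      (mem_of_mem_nhds hmem)).hasFDerivWithinAt.hasFDerivAt hmem
    have h2 : HasDerivAt (fun s : ℝ => (s, x)) ((1 : ℝ), (0 : ℝ)) s :=
      (hasDerivAt_id s).prodMk (hasDerivAt_const s x)
    exact h1.comp_hasDerivAt s h2
  have hslice : ∀ {f : ℝ × ℝ → ℝ}, ContinuousOn f S → ∀ s, 0 < s →
      ContinuousOn (fun x => f (s, x)) (Icc 0 1) := fun hf s hs =>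
    hf.comp (by fun_prop) fun x hx => ⟨hs, hx⟩
  have hK : IsCompact (Icc (t / 2) (2 * t) ×ˢ Icc (0 : ℝ) 1) := isCompact_Icc.prod isCompact_Icc
  have hKS : Icc (t / 2) (2 * t) ×ˢ Icc (0 : ℝ) 1 ⊆ S :=
    prod_mono (fun s hs => lt_of_lt_of_le (by linarith : 0 < t / 2) hs.1) le_rfl
  obtain ⟨C, hC⟩ := hK.exists_bound_of_continuousOn (hDc.mono hKS)
  have hmain := hasDerivAt_integral_of_dominated_loc_of_deriv_le
    (μ := volume.restrict (Ioo (0 : ℝ) 1)) (x₀ := t) (s := Icc (t / 2) (2 * t))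
    (F := fun s x => phi (n + 1) x * u s x) (F' := fun s x => phi (n + 1) x * D (s, x))
    (bound := fun _ => 2 * C) (Icc_mem_nhds (by linarith) (by linarith))
    (by
      filter_upwards [Ioi_mem_nhds ht] with s hs
      exact (((continuous_phi _).continuousOn.mul (hslice hu.continuousOn s hs)).mono
        Ioo_subset_Icc_self).aestronglyMeasurable measurableSet_Ioo)
    ((((continuous_phi _).continuousOn.mul
      (hslice hu.continuousOn t ht)).integrableOn_Icc).mono_set Ioo_subset_Icc_self)
    ((((continuous_phi _).continuousOn.mul (hslice hDc t ht)).mono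
        Ioo_subset_Icc_self).aestronglyMeasurable measurableSet_Ioo)
    (by
      filter_upwards [ae_restrict_mem measurableSet_Ioo] with x hx s hs
      rw [norm_mul]
      exact mul_le_mul (abs_phi_le _ _) (hC (s, x) ⟨hs, Ioo_subset_Icc_self hx⟩)
        (norm_nonneg _) (by norm_num))
    (integrable_const _)
    (by
      filter_upwards [ae_restrict_mem measurableSet_Ioo] with x hx s hs
      exact (huD s (lt_of_lt_of_le (by linarith) hs.1) x hx).const_mul _)
  have h2 := hmain.2
  simp only [setIntegral_Ioo_eq_intervalIntegral] at h2
  refine h2.congr_deriv ?_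
  rw [← setIntegral_Ioo_eq_intervalIntegral, ← setIntegral_Ioo_eq_intervalIntegral]
  refine setIntegral_congr_fun measurableSet_Ioo fun x hx => ?_
  simp only [(huD t ht x hx).deriv]

theorem IsSolution.hasDerivAt_sineCoeff {p θ : ℝ} {k : ℝ → ℝ} {u₀ : L2} {u : ℝ → ℝ → ℝ}
    (h : IsSolution p θ k u₀ u) (n : ℕ) {t : ℝ} (ht : 0 < t) :
    HasDerivAt (fun s => sineCoeff (u s) n)
      (eigenvalue p θ n * sineCoeff (u t) n + boundaryCoeff p n * u t 1) t := by
  have hI := integral_phi_mul_iteratedDeriv_two (h.contDiffOn_two t ht) (h.left_bc t ht) n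
  convert hasDerivAt_integral_phi_mul h.contDiffOn_one n ht using 1
  have hI0 : IntervalIntegrable (fun x => phi (n + 1) x * u t x) volume 0 1 := by
    apply ContinuousOn.intervalIntegrable
    rw [uIcc_of_le zero_le_one]
    exact (continuous_phi _).continuousOn.mul (h.contDiffOn_two t ht).continuousOn
  have : ∫ x in (0 : ℝ)..1, phi (n + 1) x * deriv (fun s => u s x) t =
      ∫ x in (0 : ℝ)..1, (p * (phi (n + 1) x * iteratedDeriv 2 (u t) x) +
        θ * (phi (n + 1) x * u t x)) := by
    rw [← setIntegral_Ioo_eq_intervalIntegral, ← setIntegral_Ioo_eq_intervalIntegral]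
    refine setIntegral_congr_fun measurableSet_Ioo fun x hx => ?_
    simp only [h.pde t ht x hx]
    ring
  rw [this, intervalIntegral.integral_add (hI.1.const_mul _) (hI0.const_mul _),
    intervalIntegral.integral_const_mul, intervalIntegral.integral_const_mul, hI.2]
  unfold eigenvalue boundaryCoeff sineCoeff
  ring

theorem IsSolution.continuousOn_sineCoeff {p θ : ℝ} {k : ℝ → ℝ} {u₀ : L2} {u : ℝ → ℝ → ℝ}
    (h : IsSolution p θ k u₀ u) (n : ℕ) :
    ContinuousOn (fun s => sineCoeff (u s) n) (Ici 0) := by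
  obtain ⟨U, hU, -, hUu⟩ := h.curve
  refine (continuousOn_const.inner hU (f := fun _ => mode n)).congr fun t ht => ?_
  exact (inner_mode (hUu t ht).symm n).symm

theorem IsSolution.coeFn_zero {p θ : ℝ} {k : ℝ → ℝ} {u₀ : L2} {u : ℝ → ℝ → ℝ}
    (h : IsSolution p θ k u₀ u) : u 0 =ᵐ[volume.restrict (Ioo (0 : ℝ) 1)] u₀ := by
  obtain ⟨U, -, hU0, hUu⟩ := h.curve
  simpa only [hU0] using hUu 0 le_rfl

theorem IsSolution.sineCoeff_zero {p θ : ℝ} {k : ℝ → ℝ} {u₀ : L2} {u : ℝ → ℝ → ℝ}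
    (h : IsSolution p θ k u₀ u) (n : ℕ) : sineCoeff (u 0) n = inner ℝ (mode n) u₀ :=
  (inner_mode h.coeFn_zero.symm n).symm

/-! ### The closed system of low modes and uniqueness -/

theorem integral_kernel_mul {N : ℕ} (k : Fin N → ℝ) {g : ℝ → ℝ}
    (hg : IntervalIntegrable g volume 0 1) :
    ∫ s in (0 : ℝ)..1, kernel k s * g s = ∑ i, k i * sineCoeff g i := by
  simp only [kernel, Finset.sum_mul, mul_assoc, sineCoeff]
  rw [intervalIntegral.integral_finsetSum]
  · simp only [intervalIntegral.integral_const_mul]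
  · intro i _
    exact (hg.continuousOn_mul (continuous_phi _).continuousOn).const_mul _

theorem IsSolution.right_value {p θ : ℝ} {N : ℕ} {k : Fin N → ℝ} {u₀ : L2} {u : ℝ → ℝ → ℝ}
    (h : IsSolution p θ (kernel k) u₀ u) {t : ℝ} (ht : 0 < t) :
    u t 1 = ∑ i, k i * sineCoeff (u t) i := by
  rw [h.right_bc t ht, integral_kernel_mul]
  apply ContinuousOn.intervalIntegrable
  rw [uIcc_of_le zero_le_one]
  exact (h.contDiffOn_two t ht).continuousOn

/-- Solutions are differentiable only for `t > 0`, so Grönwall is applied on `[ε, t]` and continuity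
at `0` is used as `ε → 0`. -/
theorem norm_le_mul_exp_of_hasDerivAt {E : Type*} [NormedAddCommGroup E] [NormedSpace ℝ E]
    {f f' : ℝ → E} {K : ℝ} (hf : ContinuousOn f (Ici 0))
    (hf' : ∀ t, 0 < t → HasDerivAt f (f' t) t) (hK : ∀ t, 0 < t → ‖f' t‖ ≤ K * ‖f t‖)
    {t : ℝ} (ht : 0 ≤ t) : ‖f t‖ ≤ ‖f 0‖ * Real.exp (K * t) := by
  rcases ht.eq_or_lt with rfl | ht
  · simp
  have hlim : Filter.Tendsto (fun ε => ‖f ε‖ * Real.exp (K * (t - ε))) (nhdsWithin 0 (Ioi 0))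
      (nhds (‖f 0‖ * Real.exp (K * (t - 0)))) := by
    have h1 : Filter.Tendsto f (nhdsWithin 0 (Ioi 0)) (nhds (f 0)) :=
      (hf 0 self_mem_Ici).mono_left (nhdsWithin_mono _ Ioi_subset_Ici_self)
    have h2 : Continuous fun ε : ℝ => Real.exp (K * (t - ε)) := by fun_prop
    exact h1.norm.mul (h2.tendsto 0 |>.mono_left nhdsWithin_le_nhds)
  rw [sub_zero] at hlim
  refine ge_of_tendsto hlim ?_
  filter_upwards [Ioo_mem_nhdsGT ht] with ε hε
  have := norm_le_gronwallBound_of_norm_deriv_right_le (f := f) (f' := f') (δ := ‖f ε‖) (K := K)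
    (ε := 0) (a := ε) (b := t) (hf.mono fun s hs => hε.1.le.trans hs.1)
    (fun s hs => (hf' s (hε.1.trans_le hs.1)).hasDerivWithinAt) le_rfl
    (fun s hs => by simpa using hK s (hε.1.trans_le hs.1)) t ⟨hε.2.le, le_rfl⟩
  rwa [gronwallBound_ε0] at this

/-- The generator of the closed system formed by the first `N` sine coefficients. -/
noncomputable def generator (p θ : ℝ) {N : ℕ} (k : Fin N → ℝ) : (Fin N → ℝ) →L[ℝ] (Fin N → ℝ) :=
  ContinuousLinearMap.pi fun i =>
    eigenvalue p θ i • ContinuousLinearMap.proj i +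
      boundaryCoeff p i • ∑ j, k j • ContinuousLinearMap.proj j

theorem generator_apply (p θ : ℝ) {N : ℕ} (k : Fin N → ℝ) (y : Fin N → ℝ) (i : Fin N) :
    generator p θ k y i = eigenvalue p θ i * y i + boundaryCoeff p i * ∑ j, k j * y j := by
  simp [generator]

theorem IsSolution.sineCoeff_unique {p θ : ℝ} {N : ℕ} {k : Fin N → ℝ} {u₀ : L2}
    {u v : ℝ → ℝ → ℝ} (hu : IsSolution p θ (kernel k) u₀ u)
    (hv : IsSolution p θ (kernel k) u₀ v) {t : ℝ} (ht : 0 ≤ t) (n : ℕ) :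
    sineCoeff (u t) n = sineCoeff (v t) n := by
  have hlow : ∀ t, 0 ≤ t → ∀ i : Fin N, sineCoeff (u t) i = sineCoeff (v t) i := by
    intro t ht i
    have := norm_le_mul_exp_of_hasDerivAt
      (f := fun t (i : Fin N) => sineCoeff (u t) i - sineCoeff (v t) i)
      (f' := fun t => generator p θ k fun i => sineCoeff (u t) i - sineCoeff (v t) i)
      (K := ‖generator p θ k‖)
      (continuousOn_pi.2 fun i => (hu.continuousOn_sineCoeff i).sub (hv.continuousOn_sineCoeff i))
      (fun t ht => hasDerivAt_pi.2 fun i => by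
        refine ((hu.hasDerivAt_sineCoeff i ht).sub (hv.hasDerivAt_sineCoeff i ht)).congr_deriv ?_
        rw [generator_apply, hu.right_value ht, hv.right_value ht]
        simp only [mul_sub, Finset.sum_sub_distrib]
        ring)
      (fun t _ => ContinuousLinearMap.le_opNorm _ _) ht
    have h0 : (fun i : Fin N => sineCoeff (u 0) i - sineCoeff (v 0) i) = 0 := by
      ext i
      simp [hu.sineCoeff_zero, hv.sineCoeff_zero]
    rw [h0, norm_zero, zero_mul] at this
    have h1 := congr_fun (norm_le_zero_iff.1 this) i
    simpa [sub_eq_zero] using h1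
  -- The boundary values of `u` and `v` now agree, so for every `n` the difference solves a
  -- homogeneous scalar equation with zero initial value.
  have := norm_le_mul_exp_of_hasDerivAt
    (f := fun t => sineCoeff (u t) n - sineCoeff (v t) n)
    (f' := fun t => eigenvalue p θ n * (sineCoeff (u t) n - sineCoeff (v t) n))
    (K := |eigenvalue p θ n|)
    ((hu.continuousOn_sineCoeff n).sub (hv.continuousOn_sineCoeff n))
    (fun t ht => by
      refine ((hu.hasDerivAt_sineCoeff n ht).sub (hv.hasDerivAt_sineCoeff n ht)).congr_deriv ?_
      rw [hu.right_value ht, hv.right_value ht]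
      simp only [hlow t ht.le]
      ring)
    (fun t _ => (abs_mul _ _).le) ht
  rw [hu.sineCoeff_zero, hv.sineCoeff_zero, sub_self, norm_zero, zero_mul] at this
  exact sub_eq_zero.1 (norm_le_zero_iff.1 this)

theorem eqOn_Icc_of_sineCoeff_eq {f g : ℝ → ℝ} (hf : ContinuousOn f (Icc 0 1))
    (hg : ContinuousOn g (Icc 0 1)) (h : ∀ n, sineCoeff f n = sineCoeff g n) :
    EqOn f g (Icc 0 1) := by
  have hF := (memLp_of_continuousOn hf).coeFn_toLp
  have hG := (memLp_of_continuousOn hg).coeFn_toLp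
  have heq : (memLp_of_continuousOn hf).toLp = (memLp_of_continuousOn hg).toLp :=
    ext_inner_mode fun n => by
      rw [inner_mode hF, inner_mode hG]
      exact h n
  refine Measure.eqOn_Icc_of_ae_eq volume zero_ne_one ?_ hf hg
  rw [← restrict_Ioo_eq_restrict_Icc]
  exact hF.symm.trans ((Filter.EventuallyEq.of_eq (by rw [heq])).trans hG)

theorem IsSolution.eqOn {p θ : ℝ} {N : ℕ} {k : Fin N → ℝ} {u₀ : L2}
    {u v : ℝ → ℝ → ℝ} (hu : IsSolution p θ (kernel k) u₀ u)
    (hv : IsSolution p θ (kernel k) u₀ v) {t : ℝ} (ht : 0 < t) :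
    EqOn (u t) (v t) (Icc 0 1) :=
  eqOn_Icc_of_sineCoeff_eq (hu.contDiffOn_two t ht).continuousOn
    (hv.contDiffOn_two t ht).continuousOn fun n => hu.sineCoeff_unique hv ht.le n

/-! ### Regularity of sine series with time-dependent coefficients -/

/-- The series used below converge for every real `x`, so `C¹` can be checked on the open set `(0,∞)
× ℝ`; the strip with closed sides is reached by restriction. -/
theorem contDiffOn_one_of_partial_derivatives {f f₁ f₂ : ℝ → ℝ → ℝ}
    (h₁ : ∀ t, 0 < t → ∀ x, HasDerivAt (fun s => f s x) (f₁ t x) t)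
    (h₂ : ∀ t, 0 < t → ∀ x, HasDerivAt (f t) (f₂ t x) x)
    (c₁ : ∀ t, 0 < t → ∀ x, ContinuousAt (fun q : ℝ × ℝ => f₁ q.1 q.2) (t, x))
    (c₂ : ∀ t, 0 < t → ∀ x, ContinuousAt (fun q : ℝ × ℝ => f₂ q.1 q.2) (t, x)) :
    ContDiffOn ℝ 1 (fun q : ℝ × ℝ => f q.1 q.2) (Ioi (0 : ℝ) ×ˢ univ) := by
  have hopen : IsOpen (Ioi (0 : ℝ) ×ˢ (univ : Set ℝ)) := isOpen_Ioi.prod isOpen_univ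
  set T : ℝ →L[ℝ] (ℝ →L[ℝ] ℝ) := ContinuousLinearMap.toSpanSingletonCLE.toContinuousLinearMap
  have hd : ∀ q : ℝ × ℝ, q ∈ Ioi (0 : ℝ) ×ˢ (univ : Set ℝ) →
      HasFDerivAt (fun q : ℝ × ℝ => f q.1 q.2)
        ((T (f₁ q.1 q.2)).coprod (T (f₂ q.1 q.2))) q := by
    rintro ⟨t, x⟩ hq
    have hev : ∀ᶠ v in nhds (t, x), v ∈ Ioi (0 : ℝ) ×ˢ (univ : Set ℝ) := hopen.mem_nhds hq
    refine (hasStrictFDerivAt_uncurry_coprod (𝕜 := ℝ) (u := (t, x)) (f := f)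
      (f₁ := fun t x => T (f₁ t x)) (f₂ := fun t x => T (f₂ t x)) ?_ ?_ ?_ ?_).hasFDerivAt
    · filter_upwards [hev] with v hv
      exact (h₁ v.1 hv.1 v.2).hasFDerivAt
    · filter_upwards [hev] with v hv
      exact (h₂ v.1 hv.1 v.2).hasFDerivAt
    · exact T.continuous.continuousAt.comp (c₁ t hq.1 x)
    · exact T.continuous.continuousAt.comp (c₂ t hq.1 x)
  have h01 : (1 : WithTop ℕ∞) = 0 + 1 := by norm_num
  rw [h01, contDiffOn_succ_iff_fderiv_of_isOpen hopen]
  refine ⟨fun q hq => (hd q hq).differentiableAt.differentiableWithinAt, by simp, ?_⟩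
  rw [contDiffOn_zero]
  refine ContinuousOn.congr (f := fun q : ℝ × ℝ => (T (f₁ q.1 q.2)).coprod (T (f₂ q.1 q.2)))
    (fun q hq => ContinuousAt.continuousWithinAt ?_) fun q hq => (hd q hq).fderiv
  have e : (fun q : ℝ × ℝ => (T (f₁ q.1 q.2)).coprod (T (f₂ q.1 q.2))) = fun q =>
      (T (f₁ q.1 q.2)).comp (ContinuousLinearMap.fst ℝ ℝ ℝ) +
      (T (f₂ q.1 q.2)).comp (ContinuousLinearMap.snd ℝ ℝ ℝ) := by
    ext q <;> simp
  rw [e]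
  exact ((T.continuous.continuousAt.comp (c₁ q.1 hq.1 q.2)).clm_comp continuousAt_const).add
    ((T.continuous.continuousAt.comp (c₂ q.1 hq.1 q.2)).clm_comp continuousAt_const)

theorem summable_const_div_sq (C : ℝ) : Summable fun n : ℕ => C / ((n : ℝ) + 1) ^ 2 := by
  have h := (summable_nat_add_iff 1).2 (Real.summable_one_div_nat_pow.2 (le_refl 2))
  simpa [div_eq_mul_inv] using h.mul_left C

theorem continuousAt_tsum_mul {c ψ : ℕ → ℝ → ℝ}
    (hc : ∀ n t, 0 < t → ContinuousAt (c n) t) (hψ : ∀ n, Continuous (ψ n))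
    (hb : ∀ τ T, 0 < τ → ∃ C, ∀ n, ∀ t ∈ Ioo τ T, ∀ x, |c n t * ψ n x| ≤ C / ((n : ℝ) + 1) ^ 2)
    {t : ℝ} (ht : 0 < t) (x : ℝ) :
    ContinuousAt (fun q : ℝ × ℝ => ∑' n, c n q.1 * ψ n q.2) (t, x) := by
  obtain ⟨C, hC⟩ := hb (t / 2) (2 * t) (by linarith)
  have hcont : ContinuousOn (fun q : ℝ × ℝ => ∑' n, c n q.1 * ψ n q.2)
      (Ioo (t / 2) (2 * t) ×ˢ univ) := by
    refine continuousOn_tsum (fun n q hq => ContinuousAt.continuousWithinAt ?_)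
      (summable_const_div_sq C) fun n q hq => hC n q.1 hq.1 q.2
    have h1 : ContinuousAt (c n) q.1 := hc n q.1 (by linarith [hq.1.1])
    exact (h1.comp continuousAt_fst).mul ((hψ n).comp continuous_snd).continuousAt
  exact hcont.continuousAt ((isOpen_Ioo.prod isOpen_univ).mem_nhds
    ⟨⟨by linarith, by linarith⟩, mem_univ _⟩)

/-- The wave number `(n+1)π` of `φ_{n+1}`. -/
noncomputable def waveNumber (n : ℕ) : ℝ := (n + 1) * Real.pi

theorem le_waveNumber (n : ℕ) : (n : ℝ) + 1 ≤ waveNumber n := by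
  unfold waveNumber
  nlinarith [Real.pi_gt_three, (Nat.cast_nonneg n : (0 : ℝ) ≤ n)]

theorem one_le_waveNumber (n : ℕ) : 1 ≤ waveNumber n := by
  have := le_waveNumber n
  linarith [(Nat.cast_nonneg n : (0 : ℝ) ≤ n)]

/-- The natural factor is `waveNumber n`; its square is allowed so that the single weight in
`RegularCoeffs` controls the first derivative too. -/
theorem abs_phiDeriv_le (n : ℕ) (x : ℝ) : |phiDeriv (n + 1) x| ≤ 2 * waveNumber n ^ 2 := by
  have e : phiDeriv (n + 1) x = waveNumber n * (√2 * Real.cos ((n + 1 : ℕ) * Real.pi * x)) := by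
    unfold phiDeriv waveNumber; push_cast; ring
  have h0 := one_le_waveNumber n
  have h1 : √2 ≤ 2 := Real.sqrt_le_iff.2 ⟨by norm_num, by norm_num⟩
  have h2 := Real.abs_cos_le_one ((n + 1 : ℕ) * Real.pi * x)
  rw [e, abs_mul, abs_mul, abs_of_nonneg (Real.sqrt_nonneg 2), abs_of_nonneg (by linarith)]
  have h3 : √2 * |Real.cos ((n + 1 : ℕ) * Real.pi * x)| ≤ 2 := by
    nlinarith [Real.sqrt_nonneg 2, abs_nonneg (Real.cos ((n + 1 : ℕ) * Real.pi * x))]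
  nlinarith

/-- Bounds which make a sine series with time-dependent coefficients `v` twice differentiable in
space and once in time (with coefficients `v'`), locally uniformly in positive time. -/
def RegularCoeffs (v v' : ℕ → ℝ → ℝ) : Prop :=
  ∀ τ T, 0 < τ → ∃ C, ∀ n, ∀ t ∈ Ioo τ T,
    waveNumber n ^ 2 * |v n t| ≤ C / ((n : ℝ) + 1) ^ 2 ∧ |v' n t| ≤ C / ((n : ℝ) + 1) ^ 2

namespace RegularCoeffs

variable {v v' : ℕ → ℝ → ℝ}

theorem abs_le_of_mem {C : ℝ} {n : ℕ} {t : ℝ}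
    (h : waveNumber n ^ 2 * |v n t| ≤ C / ((n : ℝ) + 1) ^ 2) :
    |v n t| ≤ C / ((n : ℝ) + 1) ^ 2 :=
  le_trans (le_mul_of_one_le_left (abs_nonneg _) (one_le_pow₀ (one_le_waveNumber n))) h

theorem bound_phi (h : RegularCoeffs v v') (τ T : ℝ) (hτ : 0 < τ) :
    ∃ C, ∀ n, ∀ t ∈ Ioo τ T, ∀ x, |v n t * phi (n + 1) x| ≤ C / ((n : ℝ) + 1) ^ 2 := by
  obtain ⟨C, hC⟩ := h τ T hτ
  refine ⟨C * 2, fun n t ht x => ?_⟩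
  rw [abs_mul, mul_div_right_comm]
  exact mul_le_mul (abs_le_of_mem (hC n t ht).1) (abs_phi_le _ _) (abs_nonneg _)
    ((abs_nonneg _).trans (hC n t ht).2)

theorem bound_phi' (h : RegularCoeffs v v') (τ T : ℝ) (hτ : 0 < τ) :
    ∃ C, ∀ n, ∀ t ∈ Ioo τ T, ∀ x, |v' n t * phi (n + 1) x| ≤ C / ((n : ℝ) + 1) ^ 2 := by
  obtain ⟨C, hC⟩ := h τ T hτ
  refine ⟨C * 2, fun n t ht x => ?_⟩
  rw [abs_mul, mul_div_right_comm]
  exact mul_le_mul (hC n t ht).2 (abs_phi_le _ _) (abs_nonneg _)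
    ((abs_nonneg _).trans (hC n t ht).2)

theorem bound_phiDeriv (h : RegularCoeffs v v') (τ T : ℝ) (hτ : 0 < τ) :
    ∃ C, ∀ n, ∀ t ∈ Ioo τ T, ∀ x, |v n t * phiDeriv (n + 1) x| ≤ C / ((n : ℝ) + 1) ^ 2 := by
  obtain ⟨C, hC⟩ := h τ T hτ
  refine ⟨C * 2, fun n t ht x => ?_⟩
  rw [abs_mul, mul_div_right_comm]
  have := mul_le_mul_of_nonneg_left (abs_phiDeriv_le n x) (abs_nonneg (v n t))
  linarith [(hC n t ht).1]

theorem bound_phiDeriv2 (h : RegularCoeffs v v') (τ T : ℝ) (hτ : 0 < τ) :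
    ∃ C, ∀ n, ∀ t ∈ Ioo τ T, ∀ x, |v n t * (-waveNumber n ^ 2 * phi (n + 1) x)| ≤
      C / ((n : ℝ) + 1) ^ 2 := by
  obtain ⟨C, hC⟩ := h τ T hτ
  refine ⟨C * 2, fun n t ht x => ?_⟩
  rw [abs_mul, abs_mul, abs_neg, abs_of_nonneg (sq_nonneg (waveNumber n)), mul_div_right_comm]
  have := mul_le_mul (hC n t ht).1 (abs_phi_le (n + 1) x) (abs_nonneg _)
    ((abs_nonneg _).trans (hC n t ht).2)
  linarith

theorem summable_abs (h : RegularCoeffs v v') {t : ℝ} (ht : 0 < t) : Summable fun n => |v n t| := by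
  obtain ⟨C, hC⟩ := h (t / 2) (2 * t) (by linarith)
  exact Summable.of_nonneg_of_le (fun _ => abs_nonneg _)
    (fun n => abs_le_of_mem (hC n t ⟨by linarith, by linarith⟩).1) (summable_const_div_sq C)

theorem hasDerivAt_time (h : RegularCoeffs v v')
    (hv : ∀ n t, 0 < t → HasDerivAt (v n) (v' n t) t) {t : ℝ} (ht : 0 < t) (x : ℝ) :
    HasDerivAt (fun s => ∑' n, v n s * phi (n + 1) x) (∑' n, v' n t * phi (n + 1) x) t := by
  obtain ⟨C, hC⟩ := h.bound_phi (t / 2) (2 * t) (by linarith)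
  obtain ⟨C', hC'⟩ := h.bound_phi' (t / 2) (2 * t) (by linarith)
  have hm : t ∈ Ioo (t / 2) (2 * t) := ⟨by linarith, by linarith⟩
  exact hasDerivAt_tsum_of_isPreconnected (summable_const_div_sq C') isOpen_Ioo isPreconnected_Ioo
    (fun n s hs => (hv n s (by linarith [hs.1])).mul_const _)
    (fun n s hs => hC' n s hs x) hm
    (.of_norm_bounded (summable_const_div_sq C) fun n => hC n t hm x) hm

theorem hasDerivAt_space (h : RegularCoeffs v v') {t : ℝ} (ht : 0 < t) (x : ℝ) :
    HasDerivAt (fun x => ∑' n, v n t * phi (n + 1) x) (∑' n, v n t * phiDeriv (n + 1) x) x := by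
  obtain ⟨C, hC⟩ := h.bound_phi (t / 2) (2 * t) (by linarith)
  obtain ⟨C', hC'⟩ := h.bound_phiDeriv (t / 2) (2 * t) (by linarith)
  have hm : t ∈ Ioo (t / 2) (2 * t) := ⟨by linarith, by linarith⟩
  exact hasDerivAt_tsum (summable_const_div_sq C')
    (fun n y => (hasDerivAt_phi (n + 1) y).const_mul _) (fun n y => hC' n t hm y)
    (.of_norm_bounded (summable_const_div_sq C) fun n => hC n t hm x) x

theorem hasDerivAt_space2 (h : RegularCoeffs v v') {t : ℝ} (ht : 0 < t) (x : ℝ) :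
    HasDerivAt (fun x => ∑' n, v n t * phiDeriv (n + 1) x)
      (∑' n, v n t * (-waveNumber n ^ 2 * phi (n + 1) x)) x := by
  obtain ⟨C, hC⟩ := h.bound_phiDeriv (t / 2) (2 * t) (by linarith)
  obtain ⟨C', hC'⟩ := h.bound_phiDeriv2 (t / 2) (2 * t) (by linarith)
  have hm : t ∈ Ioo (t / 2) (2 * t) := ⟨by linarith, by linarith⟩
  exact hasDerivAt_tsum (summable_const_div_sq C')
    (fun n y => ((hasDerivAt_phiDeriv (n + 1) y).const_mul (v n t)).congr_deriv
      (by unfold waveNumber; push_cast; ring)) (fun n y => hC' n t hm y)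
    (.of_norm_bounded (summable_const_div_sq C) fun n => hC n t hm x) x

theorem continuousAt_time (h : RegularCoeffs v v')
    (hv' : ∀ n t, 0 < t → ContinuousAt (v' n) t) {t : ℝ} (ht : 0 < t) (x : ℝ) :
    ContinuousAt (fun q : ℝ × ℝ => ∑' n, v' n q.1 * phi (n + 1) q.2) (t, x) :=
  continuousAt_tsum_mul hv' (fun n => continuous_phi (n + 1)) h.bound_phi' ht x

theorem continuousAt_space (h : RegularCoeffs v v')
    (hv : ∀ n t, 0 < t → HasDerivAt (v n) (v' n t) t) {t : ℝ} (ht : 0 < t) (x : ℝ) :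
    ContinuousAt (fun q : ℝ × ℝ => ∑' n, v n q.1 * phiDeriv (n + 1) q.2) (t, x) :=
  continuousAt_tsum_mul (fun n t ht => (hv n t ht).continuousAt)
    (fun n => continuous_phiDeriv (n + 1)) h.bound_phiDeriv ht x

theorem continuous_space2 (h : RegularCoeffs v v') {t : ℝ} (ht : 0 < t) :
    Continuous fun x => ∑' n, v n t * (-waveNumber n ^ 2 * phi (n + 1) x) := by
  obtain ⟨C', hC'⟩ := h.bound_phiDeriv2 (t / 2) (2 * t) (by linarith)
  have hm : t ∈ Ioo (t / 2) (2 * t) := ⟨by linarith, by linarith⟩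
  exact continuous_tsum (fun n => continuous_const.mul (continuous_const.mul (continuous_phi _)))
    (summable_const_div_sq C') fun n x => hC' n t hm x

theorem summable_phi (h : RegularCoeffs v v') {t : ℝ} (ht : 0 < t) (x : ℝ) :
    Summable fun n => v n t * phi (n + 1) x := by
  obtain ⟨C, hC⟩ := h.bound_phi (t / 2) (2 * t) (by linarith)
  exact .of_norm_bounded (summable_const_div_sq C) fun n => hC n t ⟨by linarith, by linarith⟩ x

theorem summable_phiDeriv2 (h : RegularCoeffs v v') {t : ℝ} (ht : 0 < t) (x : ℝ) :
    Summable fun n => v n t * (-waveNumber n ^ 2 * phi (n + 1) x) := by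
  obtain ⟨C, hC⟩ := h.bound_phiDeriv2 (t / 2) (2 * t) (by linarith)
  exact .of_norm_bounded (summable_const_div_sq C) fun n => hC n t ⟨by linarith, by linarith⟩ x

end RegularCoeffs

theorem sineCoeff_tsum {c : ℕ → ℝ} (hc : Summable fun n => |c n|) (m : ℕ) :
    sineCoeff (fun x => ∑' n, c n * phi (n + 1) x) m = c m := by
  have hb : ∀ n x, |phi (m + 1) x * (c n * phi (n + 1) x)| ≤ 4 * |c n| := by
    intro n x
    rw [abs_mul, abs_mul]
    have h1 := abs_phi_le (m + 1) x
    have h2 := abs_phi_le (n + 1) x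
    calc |phi (m + 1) x| * (|c n| * |phi (n + 1) x|) ≤ 2 * (|c n| * 2) := by gcongr
      _ = 4 * |c n| := by ring
  have hs : ∀ x, Summable fun n => c n * phi (n + 1) x := fun x =>
    .of_norm_bounded (hc.mul_right 2) fun n => by
      rw [norm_mul]
      exact mul_le_mul_of_nonneg_left (abs_phi_le _ _) (abs_nonneg _)
  have h := intervalIntegral.hasSum_integral_of_dominated_convergence (a := 0) (b := 1)
    (μ := volume) (F := fun n x => phi (m + 1) x * (c n * phi (n + 1) x))
    (f := fun x => phi (m + 1) x * ∑' n, c n * phi (n + 1) x)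
    (fun n _ => 4 * |c n|)
    (fun n => ((continuous_phi _).mul
      (continuous_const.mul (continuous_phi _))).aestronglyMeasurable)
    (fun n => .of_forall fun x _ => hb n x)
    (.of_forall fun x _ => hc.mul_left 4) intervalIntegrable_const
    (.of_forall fun x _ => (hs x).hasSum.mul_left _)
  have h2 : ∀ n, ∫ x in (0 : ℝ)..1, phi (m + 1) x * (c n * phi (n + 1) x) =
      if n = m then c m else 0 := by
    intro n
    simp only [mul_left_comm (phi (m + 1) _) (c n)]
    rw [intervalIntegral.integral_const_mul, integral_phi_mul_phi]
    by_cases hmn : m = n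
    · simp [hmn]
    · simp [hmn, Ne.symm hmn]
  simp only [h2] at h
  exact h.unique (hasSum_ite_eq m (c m))

/-- A curve in `L²(0,1)` with prescribed continuous sine coefficients. -/
theorem exists_continuousOn_curve {c : ℕ → ℝ → ℝ} (hc : ∀ n, Continuous (c n))
    (hb : ∀ T, ∃ B : ℕ → ℝ, Summable B ∧ ∀ n, ∀ t ∈ Icc 0 T, c n t ^ 2 ≤ B n) :
    ∃ V : ℝ → L2, ContinuousOn V (Ici 0) ∧ ∀ t, 0 ≤ t → ∀ n, inner ℝ (mode n) (V t) = c n t := by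
  have hsum : ∀ t, 0 ≤ t → ∃ f : L2, ∀ n, inner ℝ (mode n) f = c n t := by
    intro t ht
    obtain ⟨B, hB, hB'⟩ := hb t
    exact exists_inner_mode_eq (.of_nonneg_of_le (fun _ => sq_nonneg _)
      (fun n => hB' n t ⟨ht, le_rfl⟩) hB)
  choose! V hV using hsum
  refine ⟨V, fun t₀ ht₀ => ?_, hV⟩
  have ht₀' : (0 : ℝ) ≤ t₀ := ht₀
  obtain ⟨B, hB, hB'⟩ := hb (t₀ + 1)
  have hnorm : ∀ t, 0 ≤ t → ‖V t - V t₀‖ ^ 2 = ∑' n, (c n t - c n t₀) ^ 2 := by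
    intro t ht
    rw [← (hasSum_sq_inner_mode (V t - V t₀)).tsum_eq]
    simp only [inner_sub_right, hV t ht, hV t₀ ht₀']
  have hlim : Filter.Tendsto (fun t => ∑' n, (c n t - c n t₀) ^ 2) (nhdsWithin t₀ (Ici 0))
      (nhds (∑' _ : ℕ, (0 : ℝ))) := by
    -- The majorant comes from `(a - b)² ≤ 2a² + 2b² ≤ 4 B n`.
    refine tendsto_tsum_of_dominated_convergence (bound := fun n => 4 * B n) (hB.mul_left 4)
      (fun n => ?_) ?_
    · have : Continuous fun t => (c n t - c n t₀) ^ 2 := by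
        have := hc n
        fun_prop
      simpa using (this.tendsto t₀).mono_left nhdsWithin_le_nhds
    · have h1 : Iio (t₀ + 1) ∈ nhdsWithin t₀ (Ici 0) :=
        mem_nhdsWithin_of_mem_nhds (Iio_mem_nhds (by linarith))
      filter_upwards [h1, self_mem_nhdsWithin] with t ht1 ht0 n
      rw [Real.norm_of_nonneg (sq_nonneg _)]
      have h2 := hB' n t ⟨ht0, le_of_lt ht1⟩
      have h3 := hB' n t₀ ⟨ht₀', by linarith⟩
      nlinarith [sq_nonneg (c n t + c n t₀)]
  rw [tsum_zero] at hlim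
  have h2 : Filter.Tendsto (fun t => ‖V t - V t₀‖ ^ 2) (nhdsWithin t₀ (Ici 0)) (nhds 0) :=
    hlim.congr' (by
      filter_upwards [self_mem_nhdsWithin] with t ht
      exact (hnorm t ht).symm)
  refine (tendsto_iff_norm_sub_tendsto_zero (b := V t₀)).2 ?_
  have h3 := h2.sqrt
  simpa [Real.sqrt_sq] using h3

/-! ### Duhamel's formula -/

/-- The solution at time `t` of `y' = l y + G`, `y 0 = 0`. -/
noncomputable def duhamel (l : ℝ) (G : ℝ → ℝ) (t : ℝ) : ℝ :=
  ∫ s in (0 : ℝ)..t, Real.exp (l * (t - s)) * G s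

theorem duhamel_zero (l : ℝ) (G : ℝ → ℝ) : duhamel l G 0 = 0 := by simp [duhamel]

theorem hasDerivAt_duhamel (l : ℝ) {G : ℝ → ℝ} (hG : Continuous G) (t : ℝ) :
    HasDerivAt (duhamel l G) (l * duhamel l G t + G t) t := by
  have e : duhamel l G = fun t => Real.exp (l * t) * ∫ s in (0 : ℝ)..t, Real.exp (-(l * s)) * G s := by
    ext t
    rw [duhamel, ← intervalIntegral.integral_const_mul]
    congr 1
    ext s
    rw [mul_sub, sub_eq_add_neg, Real.exp_add, mul_assoc]
  have hc : Continuous fun s => Real.exp (-(l * s)) * G s := by fun_prop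
  have h1 := (hc.integral_hasStrictDerivAt 0 t).hasDerivAt
  have h2 : HasDerivAt (fun t => Real.exp (l * t)) (Real.exp (l * t) * l) t := by
    simpa using ((hasDerivAt_id t).const_mul l).exp
  rw [e]
  refine (h2.mul h1).congr_deriv ?_
  rw [← mul_assoc (Real.exp (l * t)) (Real.exp (-(l * t))), ← Real.exp_add]
  simp only [add_neg_cancel, Real.exp_zero]
  ring

/-- The gain `1/μ` is the integral of `exp (-μ (t - s))`. The growth due to `θ` is bounded
separately by `exp (|θ| t)`, so the sign of `θ - μ` plays no role. -/
theorem abs_duhamel_le {θ μ : ℝ} (hμ : 0 < μ) {G : ℝ → ℝ} {K t : ℝ}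
    (ht : 0 ≤ t) (hK : ∀ s ∈ Icc 0 t, |G s| ≤ K) :
    |duhamel (θ - μ) G t| ≤ Real.exp (|θ| * t) * K / μ := by
  have hK0 : 0 ≤ K := (abs_nonneg _).trans (hK 0 ⟨le_rfl, ht⟩)
  have hint : ∫ s in (0 : ℝ)..t, Real.exp (|θ| * t) * K * Real.exp (-μ * (t - s)) =
      Real.exp (|θ| * t) * K * ((1 - Real.exp (-μ * t)) / μ) := by
    rw [intervalIntegral.integral_const_mul]
    congr 1
    have h := intervalIntegral.integral_eq_sub_of_hasDerivAt (a := 0) (b := t)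
      (f := fun s => Real.exp (-μ * (t - s)) / μ) (f' := fun s => Real.exp (-μ * (t - s)))
      (fun s _ => by
        have h1 : HasDerivAt (fun s => -μ * (t - s)) μ s := by
          simpa using ((hasDerivAt_id s).const_sub t).const_mul (-μ)
        refine (h1.exp.div_const μ).congr_deriv ?_
        field_simp)
      (Continuous.intervalIntegrable (by fun_prop) _ _)
    rw [h]
    simp [sub_div]
  have hle := intervalIntegral.norm_integral_le_of_norm_le (μ := volume) (a := 0) (b := t)
    (f := fun s => Real.exp ((θ - μ) * (t - s)) * G s)
    (g := fun s => Real.exp (|θ| * t) * K * Real.exp (-μ * (t - s))) ht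
    (.of_forall fun s hs => by
      rw [norm_mul, Real.norm_of_nonneg (Real.exp_pos _).le]
      have h1 : Real.exp ((θ - μ) * (t - s)) ≤ Real.exp (|θ| * t) * Real.exp (-μ * (t - s)) := by
        rw [← Real.exp_add]
        apply Real.exp_le_exp.2
        have : θ * (t - s) ≤ |θ| * t := by
          nlinarith [le_abs_self θ, abs_nonneg θ, hs.1, hs.2]
        linarith
      calc Real.exp ((θ - μ) * (t - s)) * ‖G s‖
          ≤ Real.exp (|θ| * t) * Real.exp (-μ * (t - s)) * K :=
            mul_le_mul h1 (hK s ⟨hs.1.le, hs.2⟩) (norm_nonneg _) (by positivity)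
        _ = _ := by ring)
    (Continuous.intervalIntegrable (by fun_prop) _ _)
  rw [hint] at hle
  refine hle.trans ?_
  have h1 : (1 - Real.exp (-μ * t)) / μ ≤ 1 / μ := by
    gcongr
    linarith [Real.exp_pos (-μ * t)]
  calc Real.exp (|θ| * t) * K * ((1 - Real.exp (-μ * t)) / μ)
      ≤ Real.exp (|θ| * t) * K * (1 / μ) := by gcongr
    _ = Real.exp (|θ| * t) * K / μ := by ring

/-! ### Lifting of the boundary value -/

/-- The function with `p h'' = x` and `h 0 = h 1 = 0`. -/
noncomputable def cubic (p x : ℝ) : ℝ := (x ^ 3 - x) / (6 * p)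

/-- The derivative of `cubic p`. -/
noncomputable def cubicDeriv (p x : ℝ) : ℝ := (3 * x ^ 2 - 1) / (6 * p)

theorem hasDerivAt_cubic (p x : ℝ) : HasDerivAt (cubic p) (cubicDeriv p x) x := by
  refine (((hasDerivAt_pow 3 x).sub (hasDerivAt_id x)).div_const (6 * p)).congr_deriv ?_
  simp [cubicDeriv]

theorem hasDerivAt_cubicDeriv (p x : ℝ) : HasDerivAt (cubicDeriv p) (x / p) x := by
  refine ((((hasDerivAt_pow 2 x).const_mul 3).sub_const 1).div_const (6 * p)).congr_deriv ?_
  push_cast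
  by_cases hp : p = 0
  · simp [hp]
  · field_simp; ring

theorem continuous_cubic (p : ℝ) : Continuous (cubic p) := by unfold cubic; fun_prop

theorem continuous_cubicDeriv (p : ℝ) : Continuous (cubicDeriv p) := by unfold cubicDeriv; fun_prop

theorem iteratedDeriv_two_eq {f f' f'' : ℝ → ℝ} (h : ∀ x, HasDerivAt f (f' x) x)
    (h' : ∀ x, HasDerivAt f' (f'' x) x) : iteratedDeriv 2 f = f'' := by
  rw [iteratedDeriv_succ, iteratedDeriv_one, show deriv f = f' from funext fun x => (h x).deriv]
  exact funext fun x => (h' x).deriv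

theorem contDiff_two_of_hasDerivAt {f f' f'' : ℝ → ℝ} (h : ∀ x, HasDerivAt f (f' x) x)
    (h' : ∀ x, HasDerivAt f' (f'' x) x) (hc : Continuous f'') : ContDiff ℝ 2 f := by
  have h2 : (2 : WithTop ℕ∞) = 1 + 1 := by norm_num
  rw [h2, contDiff_succ_iff_deriv]
  refine ⟨fun x => (h x).differentiableAt, by simp, ?_⟩
  rw [show deriv f = f' from funext fun x => (h x).deriv, contDiff_one_iff_deriv]
  refine ⟨fun x => (h' x).differentiableAt, ?_⟩
  rwa [show deriv f' = f'' from funext fun x => (h' x).deriv]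

/-- Integration by parts applied to `g(x) = x`, whose second derivative is zero. -/
theorem waveNumber_mul_sineCoeff_id (n : ℕ) :
    waveNumber n * sineCoeff (fun x => x) n = √2 * (-1) ^ n := by
  have h := (integral_phi_mul_iteratedDeriv_two (g := fun x => x) contDiffOn_id rfl n).2
  rw [iteratedDeriv_two_eq (f := fun x => x) (f' := fun _ => 1) (f'' := fun _ => 0)
    (fun x => hasDerivAt_id' x)
    (fun x => hasDerivAt_const x 1)] at h
  simp only [mul_zero, intervalIntegral.integral_zero, mul_one] at h
  have h0 : waveNumber n ≠ 0 := (zero_lt_one.trans_le (one_le_waveNumber n)).ne'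
  apply mul_left_cancel₀ h0
  unfold waveNumber at *
  linear_combination h

/-- The same integration by parts for the cubic, which vanishes at both ends and satisfies `p h'' =
x`. -/
theorem sineCoeff_id_eq {p : ℝ} (hp : 0 < p) (n : ℕ) :
    sineCoeff (fun x => x) n = -(p * waveNumber n ^ 2 * sineCoeff (cubic p) n) := by
  have hcd : ContDiff ℝ 2 (cubic p) :=
    contDiff_two_of_hasDerivAt (hasDerivAt_cubic p) (hasDerivAt_cubicDeriv p) (by fun_prop)
  have h := (integral_phi_mul_iteratedDeriv_two (g := cubic p) hcd.contDiffOn (by simp [cubic]) n).2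
  rw [iteratedDeriv_two_eq (hasDerivAt_cubic p) (hasDerivAt_cubicDeriv p)] at h
  simp only [← mul_div_assoc, intervalIntegral.integral_div] at h
  rw [show cubic p 1 = 0 by simp [cubic], mul_zero, add_zero, div_eq_iff hp.ne'] at h
  unfold sineCoeff waveNumber at *
  linear_combination h

theorem boundaryCoeff_eq (p : ℝ) (n : ℕ) :
    boundaryCoeff p n = p * waveNumber n ^ 2 * sineCoeff (fun x => x) n := by
  have := waveNumber_mul_sineCoeff_id n
  unfold boundaryCoeff
  change p * (√2 * waveNumber n * (-1) ^ n) = _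
  linear_combination -p * waveNumber n * this

theorem eigenvalue_eq (p θ : ℝ) (n : ℕ) : eigenvalue p θ n = θ - p * waveNumber n ^ 2 := rfl

/-- The two preceding identities give exact decay of order `waveNumber n ^ (-3)`; a quadratic rate
is enough later. -/
theorem abs_sineCoeff_cubic_le {p : ℝ} (hp : 0 < p) (n : ℕ) :
    |sineCoeff (cubic p) n| ≤ 2 / p / ((n : ℝ) + 1) ^ 2 := by
  have h0 := one_le_waveNumber n
  have h1 := waveNumber_mul_sineCoeff_id n
  rw [sineCoeff_id_eq hp] at h1
  have h2 : p * waveNumber n ^ 3 * |sineCoeff (cubic p) n| = √2 := by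
    have h3 : p * waveNumber n ^ 3 * sineCoeff (cubic p) n = -(√2 * (-1) ^ n) := by
      linear_combination -h1
    have h4 := congr_arg abs h3
    rwa [abs_mul, abs_neg, abs_mul √2, abs_pow (-1 : ℝ), abs_neg, abs_one, one_pow, mul_one,
      abs_of_nonneg (Real.sqrt_nonneg 2), abs_of_nonneg (by positivity)] at h4
  have h5 : √2 ≤ 2 := Real.sqrt_le_iff.2 ⟨by norm_num, by norm_num⟩
  have h6 : ((n : ℝ) + 1) ^ 2 ≤ waveNumber n ^ 3 :=
    calc ((n : ℝ) + 1) ^ 2 ≤ waveNumber n ^ 2 := by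
          gcongr; exact le_waveNumber n
      _ ≤ waveNumber n ^ 3 := pow_le_pow_right₀ h0 (by norm_num)
  rw [div_div, le_div_iff₀ (by positivity)]
  calc |sineCoeff (cubic p) n| * (p * ((n : ℝ) + 1) ^ 2)
      ≤ |sineCoeff (cubic p) n| * (p * waveNumber n ^ 3) := by gcongr
    _ = √2 := by rw [← h2]; ring
    _ ≤ 2 := h5

/-! ### Size and smoothing of the mode coefficients -/

/-- The solution of `v' = λₙ v + h n G`, `v 0 = a n`, where `λₙ = eigenvalue p θ n`. -/
noncomputable def modeCoeff (p θ : ℝ) (a h : ℕ → ℝ) (G : ℝ → ℝ) (n : ℕ) (t : ℝ) : ℝ :=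
  Real.exp (eigenvalue p θ n * t) * a n + h n * duhamel (eigenvalue p θ n) G t

theorem modeCoeff_zero (p θ : ℝ) (a h : ℕ → ℝ) (G : ℝ → ℝ) (n : ℕ) :
    modeCoeff p θ a h G n 0 = a n := by
  simp [modeCoeff, duhamel_zero]

theorem hasDerivAt_modeCoeff (p θ : ℝ) (a h : ℕ → ℝ) {G : ℝ → ℝ} (hG : Continuous G) (n : ℕ)
    (t : ℝ) : HasDerivAt (modeCoeff p θ a h G n)
      (eigenvalue p θ n * modeCoeff p θ a h G n t + h n * G t) t := by
  have h2 : HasDerivAt (fun t => Real.exp (eigenvalue p θ n * t))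
      (Real.exp (eigenvalue p θ n * t) * eigenvalue p θ n) t := by
    simpa using ((hasDerivAt_id t).const_mul (eigenvalue p θ n)).exp
  refine ((h2.mul_const (a n)).add ((hasDerivAt_duhamel _ hG t).const_mul (h n))).congr_deriv ?_
  unfold modeCoeff
  ring

theorem exp_eigenvalue_le (p θ : ℝ) (n : ℕ) {t : ℝ} (ht : 0 ≤ t) :
    Real.exp (eigenvalue p θ n * t) ≤
      Real.exp (|θ| * t) * Real.exp (-(p * waveNumber n ^ 2 * t)) := by
  rw [← Real.exp_add, eigenvalue_eq]
  apply Real.exp_le_exp.2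
  nlinarith [le_abs_self θ]

theorem abs_modeCoeff_le {p : ℝ} (hp : 0 < p) (θ : ℝ) (a h : ℕ → ℝ) {G : ℝ → ℝ} (n : ℕ)
    {K t : ℝ} (ht : 0 ≤ t) (hK : ∀ s ∈ Icc 0 t, |G s| ≤ K) :
    |modeCoeff p θ a h G n t| ≤ Real.exp (|θ| * t) *
      (Real.exp (-(p * waveNumber n ^ 2 * t)) * |a n| + K / (p * waveNumber n ^ 2) * |h n|) := by
  have h0 := one_le_waveNumber n
  have h1 := abs_duhamel_le (θ := θ) (μ := p * waveNumber n ^ 2) (by positivity) ht hK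
  rw [← eigenvalue_eq] at h1
  have h2 := exp_eigenvalue_le p θ n ht
  unfold modeCoeff
  refine (abs_add_le _ _).trans ?_
  rw [abs_mul, abs_mul, abs_of_nonneg (Real.exp_pos _).le, mul_add]
  refine add_le_add ?_ ?_
  · rw [← mul_assoc]
    gcongr
  · calc |h n| * |duhamel (eigenvalue p θ n) G t|
        ≤ |h n| * (Real.exp (|θ| * t) * K / (p * waveNumber n ^ 2)) := by gcongr
      _ = _ := by ring

/-- From `exp z ≥ 1 + z + z²/2` at `z = c y`. With `y` a squared wave number, this is the smoothing
of the heat flow at positive times. -/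
theorem sq_mul_exp_neg_le {c y : ℝ} (hc : 0 < c) (hy : 0 < y) :
    y * Real.exp (-(c * y)) ≤ 2 / c ^ 2 / y := by
  have h := Real.quadratic_le_exp_of_nonneg (show 0 ≤ c * y by positivity)
  rw [Real.exp_neg, ← div_eq_mul_inv, div_div, div_le_div_iff₀ (Real.exp_pos _) (by positivity)]
  nlinarith [mul_pos hc hy]

/-- Merely bounded initial coefficients are damped by the exponential once `t > τ > 0`. In the
forced part, Duhamel's gain `1/(p waveNumber²)` cancels the weight, leaving the quadratic decay of
`h`. -/
theorem regularCoeffs_modeCoeff {p : ℝ} (hp : 0 < p) (θ : ℝ) {a h : ℕ → ℝ} {G : ℝ → ℝ}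
    (hG : Continuous G) {M H : ℝ} (ha : ∀ n, |a n| ≤ M) (hh : ∀ n, |h n| ≤ H / ((n : ℝ) + 1) ^ 2) :
    RegularCoeffs (modeCoeff p θ a h G)
      (fun n t => eigenvalue p θ n * modeCoeff p θ a h G n t + h n * G t) := by
  intro τ T hτ
  have hM : 0 ≤ M := (abs_nonneg _).trans (ha 0)
  obtain ⟨K, hK⟩ := isCompact_Icc.exists_bound_of_continuousOn (hG.continuousOn (s := Icc 0 T))
  by_cases hT : 0 ≤ T
  swap
  · exact ⟨0, fun n t ht => absurd (hτ.trans (ht.1.trans ht.2)) (by linarith)⟩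
  have hK0 : 0 ≤ K := (norm_nonneg _).trans (hK 0 ⟨le_rfl, hT⟩)
  set C := Real.exp (|θ| * T) * (2 / (p * τ) ^ 2 * M + K / p * H) with hC
  have hfirst : ∀ n, ∀ t ∈ Ioo τ T,
      waveNumber n ^ 2 * |modeCoeff p θ a h G n t| ≤ C / ((n : ℝ) + 1) ^ 2 := by
    intro n t ht
    have h0 := one_le_waveNumber n
    have hn := le_waveNumber n
    have ht0 : 0 < t := hτ.trans ht.1
    have h1 := abs_modeCoeff_le hp θ a h n ht0.le
      (fun s hs => hK s ⟨hs.1, hs.2.trans ht.2.le⟩)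
    have h2 : waveNumber n ^ 2 * Real.exp (-(p * waveNumber n ^ 2 * t)) ≤
        2 / (p * τ) ^ 2 / ((n : ℝ) + 1) ^ 2 := by
      calc waveNumber n ^ 2 * Real.exp (-(p * waveNumber n ^ 2 * t))
          ≤ waveNumber n ^ 2 * Real.exp (-(p * τ * waveNumber n ^ 2)) := by
            gcongr _ * Real.exp (- ?_)
            nlinarith [ht.1, mul_pos hp (show 0 < waveNumber n ^ 2 by positivity)]
        _ ≤ 2 / (p * τ) ^ 2 / waveNumber n ^ 2 :=
            sq_mul_exp_neg_le (by positivity) (by positivity)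
        _ ≤ _ := by gcongr
    calc waveNumber n ^ 2 * |modeCoeff p θ a h G n t|
        ≤ waveNumber n ^ 2 * (Real.exp (|θ| * t) *
          (Real.exp (-(p * waveNumber n ^ 2 * t)) * |a n| +
            K / (p * waveNumber n ^ 2) * |h n|)) := by gcongr
      _ = Real.exp (|θ| * t) * (waveNumber n ^ 2 * Real.exp (-(p * waveNumber n ^ 2 * t)) * |a n| +
            K / p * |h n|) := by field_simp
      _ ≤ Real.exp (|θ| * T) * (2 / (p * τ) ^ 2 / ((n : ℝ) + 1) ^ 2 * M +
            K / p * (H / ((n : ℝ) + 1) ^ 2)) := by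
          have := ht.2.le
          have := ha n
          have := hh n
          gcongr
      _ = C / ((n : ℝ) + 1) ^ 2 := by rw [hC]; ring
  have hC0 : ∀ n : ℕ, ∀ t ∈ Ioo τ T, 0 ≤ C / ((n : ℝ) + 1) ^ 2 := fun n t ht =>
    (by positivity : 0 ≤ waveNumber n ^ 2 * |modeCoeff p θ a h G n t|).trans (hfirst n t ht)
  -- One constant for both bounds: `|θ| + p` comes from the eigenvalue, `H * K` from the forcing,
  -- and the extra `1` lets it dominate `C`.
  refine ⟨(|θ| + p + 1) * C + H * K, fun n t ht => ⟨?_, ?_⟩⟩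
  · refine (hfirst n t ht).trans ?_
    have h1 := hC0 n t ht
    have h2 : 0 ≤ H / ((n : ℝ) + 1) ^ 2 := (abs_nonneg _).trans (hh n)
    have h3 : ((|θ| + p + 1) * C + H * K) / ((n : ℝ) + 1) ^ 2 =
        (|θ| + p + 1) * (C / ((n : ℝ) + 1) ^ 2) + H / ((n : ℝ) + 1) ^ 2 * K := by ring
    rw [h3]
    nlinarith [mul_nonneg h2 hK0, mul_nonneg (add_nonneg (abs_nonneg θ) hp.le) h1]
  · have h1 := hfirst n t ht
    have h0 := one_le_waveNumber n
    have h2 : |eigenvalue p θ n| ≤ (|θ| + p) * waveNumber n ^ 2 := by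
      rw [eigenvalue_eq]
      refine (abs_sub _ _).trans ?_
      rw [abs_of_nonneg (show 0 ≤ p * waveNumber n ^ 2 by positivity), add_mul]
      gcongr
      exact le_mul_of_one_le_right (abs_nonneg _) (one_le_pow₀ h0)
    have h3 : |G t| ≤ K := hK t ⟨(hτ.trans ht.1).le, ht.2.le⟩
    calc |eigenvalue p θ n * modeCoeff p θ a h G n t + h n * G t|
        ≤ |eigenvalue p θ n| * |modeCoeff p θ a h G n t| + |h n| * |G t| := by
          refine (abs_add_le _ _).trans ?_
          rw [abs_mul, abs_mul]
      _ ≤ (|θ| + p) * waveNumber n ^ 2 * |modeCoeff p θ a h G n t| +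
          H / ((n : ℝ) + 1) ^ 2 * K := by
          have := hh n
          gcongr
          exact (abs_nonneg _).trans this
      _ ≤ (|θ| + p) * (C / ((n : ℝ) + 1) ^ 2) + H / ((n : ℝ) + 1) ^ 2 * K := by
          rw [mul_assoc]
          gcongr
      _ ≤ (|θ| + p + 1) * (C / ((n : ℝ) + 1) ^ 2) + H / ((n : ℝ) + 1) ^ 2 * K := by
          linarith [hC0 n t ht]
      _ = _ := by ring

/-- No smoothing is used, so the bound holds down to `t = 0`. Its square-summable majorant yields
both the continuity in `L²` and the norm estimate. -/
theorem sq_modeCoeff_le {p : ℝ} (hp : 0 < p) (θ : ℝ) (a h : ℕ → ℝ) {G : ℝ → ℝ} (n : ℕ)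
    {K t : ℝ} (ht : 0 ≤ t) (hK : ∀ s ∈ Icc 0 t, |G s| ≤ K) :
    modeCoeff p θ a h G n t ^ 2 ≤
      2 * Real.exp (|θ| * t) ^ 2 * (a n ^ 2 + (K / p) ^ 2 * h n ^ 2) := by
  have h0 := one_le_waveNumber n
  have hK0 : 0 ≤ K := (abs_nonneg _).trans (hK 0 ⟨le_rfl, ht⟩)
  have h1 := abs_modeCoeff_le hp θ a h n ht hK
  have h2 : Real.exp (-(p * waveNumber n ^ 2 * t)) ≤ 1 :=
    Real.exp_le_one_iff.2 (by have : 0 ≤ p * waveNumber n ^ 2 * t := by positivity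
                              linarith)
  have h3 : K / (p * waveNumber n ^ 2) ≤ K / p := by
    gcongr
    exact le_mul_of_one_le_right hp.le (one_le_pow₀ h0)
  have h4 : |modeCoeff p θ a h G n t| ≤ Real.exp (|θ| * t) * (1 * |a n| + K / p * |h n|) :=
    h1.trans (by gcongr)
  rw [← sq_abs (modeCoeff p θ a h G n t), ← sq_abs (a n), ← sq_abs (h n)]
  calc |modeCoeff p θ a h G n t| ^ 2 ≤ (Real.exp (|θ| * t) * (1 * |a n| + K / p * |h n|)) ^ 2 := by
        gcongr
    _ = Real.exp (|θ| * t) ^ 2 * (|a n| + K / p * |h n|) ^ 2 := by ring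
    _ ≤ Real.exp (|θ| * t) ^ 2 * (2 * (|a n| ^ 2 + (K / p * |h n|) ^ 2)) := by
        gcongr
        nlinarith [sq_nonneg (|a n| - K / p * |h n|)]
    _ = _ := by ring

/-! ### Boundary value generated by the closed system -/

/-- The linear flow `exp (t A) z`. -/
noncomputable def flow {E : Type*} [NormedAddCommGroup E] [NormedSpace ℝ E]
    (A : E →L[ℝ] E) (t : ℝ) (z : E) : E :=
  NormedSpace.exp (t • A) z

section Flow

variable {E : Type*} [NormedAddCommGroup E] [NormedSpace ℝ E]

theorem flow_zero (A : E →L[ℝ] E) (z : E) : flow A 0 z = z := by simp [flow]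

variable [CompleteSpace E]

/-- With `A` applied to the initial vector, differentiation only replaces `z` by `A z`, so it can be
iterated. The variant with `A` outside is the differential equation itself. -/
theorem hasDerivAt_flow (A : E →L[ℝ] E) (t : ℝ) (z : E) :
    HasDerivAt (fun t => flow A t z) (flow A t (A z)) t :=
  (hasDerivAt_exp_smul_const (𝕂 := ℝ) A t).clm_apply (hasDerivAt_const t z) |>.congr_deriv
    (by simp [flow])

theorem hasDerivAt_flow' (A : E →L[ℝ] E) (t : ℝ) (z : E) :
    HasDerivAt (fun t => flow A t z) (A (flow A t z)) t :=
  (hasDerivAt_exp_smul_const' (𝕂 := ℝ) A t).clm_apply (hasDerivAt_const t z) |>.congr_deriv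
    (by simp [flow])

theorem norm_flow_le (A : E →L[ℝ] E) {t : ℝ} (ht : 0 ≤ t) (z : E) :
    ‖flow A t z‖ ≤ ‖z‖ * Real.exp (‖A‖ * t) := by
  have := norm_le_mul_exp_of_hasDerivAt (f := fun t => flow A t z)
    (f' := fun t => A (flow A t z)) (K := ‖A‖)
    (fun t _ => (hasDerivAt_flow A t z).continuousAt.continuousWithinAt)
    (fun t _ => hasDerivAt_flow' A t z) (fun t _ => A.le_opNorm _) ht
  rwa [flow_zero] at this

end Flow

/-- The `L²` class of a continuous function. -/
noncomputable def ofContinuous {f : ℝ → ℝ} (hf : Continuous f) : L2 :=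
  (memLp_of_continuousOn hf.continuousOn).toLp

theorem coeFn_ofContinuous {f : ℝ → ℝ} (hf : Continuous f) :
    ofContinuous hf =ᵐ[volume.restrict (Ioo (0 : ℝ) 1)] f :=
  MemLp.coeFn_toLp _

theorem inner_mode_ofContinuous {f : ℝ → ℝ} (hf : Continuous f) (n : ℕ) :
    inner ℝ (mode n) (ofContinuous hf) = sineCoeff f n :=
  inner_mode (coeFn_ofContinuous hf) n

/-- The first `N` sine coefficients `y` of the solution to be constructed, together with its
boundary value `w` at `x = 1` and two derivatives of `w`. -/
structure BoundaryData (p θ : ℝ) {N : ℕ} (k : Fin N → ℝ) (u₀ : L2) where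
  /-- The first `N` sine coefficients. -/
  y : ℝ → Fin N → ℝ
  /-- The boundary value at `x = 1`. -/
  w : ℝ → ℝ
  /-- The derivative of `w`. -/
  w₁ : ℝ → ℝ
  /-- The second derivative of `w`. -/
  w₂ : ℝ → ℝ
  hasDerivAt_y : ∀ t, HasDerivAt y (generator p θ k (y t)) t
  y_zero : ∀ i : Fin N, y 0 i = inner ℝ (mode i) u₀
  w_eq : ∀ t, w t = ∑ i, k i * y t i
  hasDerivAt_w : ∀ t, HasDerivAt w (w₁ t) t
  hasDerivAt_w₁ : ∀ t, HasDerivAt w₁ (w₂ t) t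
  continuous_w₂ : Continuous w₂

theorem exists_boundaryData (p θ : ℝ) {N : ℕ} (k : Fin N → ℝ) :
    ∃ C a : ℝ, 0 ≤ C ∧ 0 ≤ a ∧ ∀ u₀ : L2, ∃ d : BoundaryData p θ k u₀, ∀ t, 0 ≤ t →
      |d.w t| ≤ C * ‖u₀‖ * Real.exp (a * t) ∧ |d.w₁ t| ≤ C * ‖u₀‖ * Real.exp (a * t) ∧
        |d.w₂ t| ≤ C * ‖u₀‖ * Real.exp (a * t) := by
  set A := generator p θ k with hA
  set κ : (Fin N → ℝ) →L[ℝ] ℝ := ∑ j, k j • ContinuousLinearMap.proj j with hκ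
  have hκa : ∀ y, κ y = ∑ j, k j * y j := fun y => by simp [hκ]
  -- Bounds the norms of `z`, `A z` and `A (A z)` at once, which generate `w`, `w₁` and `w₂`.
  set B := 1 + ‖A‖ + ‖A‖ ^ 2 with hB
  have hder : ∀ z t, HasDerivAt (fun t => κ (flow A t z)) (κ (flow A t (A z))) t := fun z t =>
    κ.hasFDerivAt.comp_hasDerivAt t (hasDerivAt_flow A t z)
  refine ⟨‖κ‖ * B, ‖A‖, by positivity, norm_nonneg _, fun u₀ => ?_⟩
  set z : Fin N → ℝ := fun i => inner ℝ (mode i) u₀ with hz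
  have hzn : ‖z‖ ≤ ‖u₀‖ :=
    (pi_norm_le_iff_of_nonneg (norm_nonneg _)).2 fun i => abs_inner_mode_le i u₀
  have hbd : ∀ x : Fin N → ℝ, ‖x‖ ≤ B * ‖u₀‖ → ∀ t, 0 ≤ t →
      |κ (flow A t x)| ≤ ‖κ‖ * B * ‖u₀‖ * Real.exp (‖A‖ * t) := by
    intro x hx t ht
    calc |κ (flow A t x)| ≤ ‖κ‖ * ‖flow A t x‖ := κ.le_opNorm _
      _ ≤ ‖κ‖ * (‖x‖ * Real.exp (‖A‖ * t)) := by gcongr; exact norm_flow_le A ht x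
      _ ≤ ‖κ‖ * (B * ‖u₀‖ * Real.exp (‖A‖ * t)) := by gcongr
      _ = _ := by ring
  have h1 : ‖A z‖ ≤ ‖A‖ * ‖u₀‖ := (A.le_opNorm z).trans (by gcongr)
  have h2 : ‖A (A z)‖ ≤ ‖A‖ ^ 2 * ‖u₀‖ :=
    (A.le_opNorm _).trans (by rw [sq, mul_assoc]; gcongr)
  have hA0 := norm_nonneg A
  refine ⟨{ y := fun t => flow A t z
            w := fun t => κ (flow A t z)
            w₁ := fun t => κ (flow A t (A z))
            w₂ := fun t => κ (flow A t (A (A z)))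
            hasDerivAt_y := fun t => hasDerivAt_flow' A t z
            y_zero := fun i => by simp [flow_zero, hz]
            w_eq := fun t => hκa _
            hasDerivAt_w := hder z
            hasDerivAt_w₁ := hder (A z)
            continuous_w₂ := continuous_iff_continuousAt.2 fun t => (hder _ t).continuousAt },
    fun t ht => ⟨hbd z (hzn.trans ?_) t ht, hbd _ (h1.trans ?_) t ht, hbd _ (h2.trans ?_) t ht⟩⟩
  · exact le_mul_of_one_le_left (norm_nonneg _) (by rw [hB]; nlinarith)
  · gcongr; rw [hB]; nlinarith
  · gcongr; rw [hB]; nlinarith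

/-! ### Construction and estimate of the solution -/

namespace BoundaryData

variable {p θ : ℝ} {N : ℕ} {k : Fin N → ℝ} {u₀ : L2} (d : BoundaryData p θ k u₀)

/-- The factor of the cubic part of the lifting of the boundary value. -/
noncomputable def m (t : ℝ) : ℝ := d.w₁ t - θ * d.w t

/-- The derivative of `m`. -/
noncomputable def m₁ (t : ℝ) : ℝ := d.w₂ t - θ * d.w₁ t

/-- The time-dependent factor of the residual of the lifting. -/
noncomputable def source (t : ℝ) : ℝ := θ * d.m t - d.m₁ t

/-- The initial value after subtracting the lifting of the boundary value. -/
noncomputable def initial : L2 :=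
  u₀ - d.w 0 • ofContinuous continuous_id' - d.m 0 • ofContinuous (continuous_cubic p)

/-- The sine coefficients of the solution after subtracting the lifting. -/
noncomputable def coeff : ℕ → ℝ → ℝ :=
  modeCoeff p θ (fun n => inner ℝ (mode n) d.initial) (sineCoeff (cubic p)) d.source

/-- The derivatives of the coefficients `coeff`. -/
noncomputable def coeffDeriv (n : ℕ) (t : ℝ) : ℝ :=
  eigenvalue p θ n * d.coeff n t + sineCoeff (cubic p) n * d.source t

/-- The solution of the boundary value problem for positive times. -/
noncomputable def solutionPos (t x : ℝ) : ℝ :=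
  x * d.w t + cubic p x * d.m t + ∑' n, d.coeff n t * phi (n + 1) x

/-- The solution of the boundary value problem. -/
noncomputable def solution (t x : ℝ) : ℝ :=
  if t ≤ 0 then u₀ x else d.solutionPos t x

theorem solution_of_pos {t : ℝ} (ht : 0 < t) : d.solution t = d.solutionPos t := by
  ext x
  simp [solution, not_le.2 ht]

theorem hasDerivAt_m (t : ℝ) : HasDerivAt d.m (d.m₁ t) t :=
  (d.hasDerivAt_w₁ t).sub ((d.hasDerivAt_w t).const_mul θ)

theorem continuous_w : Continuous d.w :=
  continuous_iff_continuousAt.2 fun t => (d.hasDerivAt_w t).continuousAt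

theorem continuous_w₁ : Continuous d.w₁ :=
  continuous_iff_continuousAt.2 fun t => (d.hasDerivAt_w₁ t).continuousAt

theorem continuous_m : Continuous d.m :=
  continuous_iff_continuousAt.2 fun t => (d.hasDerivAt_m t).continuousAt

theorem continuous_m₁ : Continuous d.m₁ :=
  d.continuous_w₂.sub (continuous_const.mul d.continuous_w₁)

theorem continuous_source : Continuous d.source :=
  (continuous_const.mul d.continuous_m).sub d.continuous_m₁

theorem hasDerivAt_coeff (n : ℕ) (t : ℝ) : HasDerivAt (d.coeff n) (d.coeffDeriv n t) t :=
  hasDerivAt_modeCoeff p θ _ _ d.continuous_source n t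

theorem continuous_coeff (n : ℕ) : Continuous (d.coeff n) :=
  continuous_iff_continuousAt.2 fun t => (d.hasDerivAt_coeff n t).continuousAt

theorem continuous_coeffDeriv (n : ℕ) : Continuous (d.coeffDeriv n) :=
  (continuous_const.mul (d.continuous_coeff n)).add (continuous_const.mul d.continuous_source)

theorem regularCoeffs (hp : 0 < p) : RegularCoeffs d.coeff d.coeffDeriv :=
  regularCoeffs_modeCoeff hp θ d.continuous_source (fun n => abs_inner_mode_le n d.initial)
    (abs_sineCoeff_cubic_le hp)

theorem hasDerivAt_solutionPos_time (hp : 0 < p) {t : ℝ} (ht : 0 < t) (x : ℝ) :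
    HasDerivAt (fun s => d.solutionPos s x)
      (x * d.w₁ t + cubic p x * d.m₁ t + ∑' n, d.coeffDeriv n t * phi (n + 1) x) t :=
  (((d.hasDerivAt_w t).const_mul x).add ((d.hasDerivAt_m t).const_mul _)).add
    ((d.regularCoeffs hp).hasDerivAt_time (fun n t _ => d.hasDerivAt_coeff n t) ht x)

theorem hasDerivAt_solutionPos_space (hp : 0 < p) {t : ℝ} (ht : 0 < t) (x : ℝ) :
    HasDerivAt (d.solutionPos t)
      (d.w t + cubicDeriv p x * d.m t + ∑' n, d.coeff n t * phiDeriv (n + 1) x) x := by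
  refine ((((hasDerivAt_id' x).mul_const (d.w t)).add
    ((hasDerivAt_cubic p x).mul_const (d.m t))).add
    ((d.regularCoeffs hp).hasDerivAt_space ht x)).congr_deriv ?_
  rw [one_mul]

theorem hasDerivAt_solutionPos_space2 (hp : 0 < p) {t : ℝ} (ht : 0 < t) (x : ℝ) :
    HasDerivAt
      (fun x => d.w t + cubicDeriv p x * d.m t + ∑' n, d.coeff n t * phiDeriv (n + 1) x)
      (x / p * d.m t + ∑' n, d.coeff n t * (-waveNumber n ^ 2 * phi (n + 1) x)) x :=
  (((hasDerivAt_cubicDeriv p x).mul_const (d.m t)).const_add (d.w t)).add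
    ((d.regularCoeffs hp).hasDerivAt_space2 ht x)

theorem contDiff_solutionPos (hp : 0 < p) {t : ℝ} (ht : 0 < t) :
    ContDiff ℝ 2 (d.solutionPos t) :=
  contDiff_two_of_hasDerivAt (d.hasDerivAt_solutionPos_space hp ht)
    (d.hasDerivAt_solutionPos_space2 hp ht)
    (((continuous_id.div_const p).mul continuous_const).add
      ((d.regularCoeffs hp).continuous_space2 ht))

theorem contDiffOn_one_solutionPos (hp : 0 < p) :
    ContDiffOn ℝ 1 (fun q : ℝ × ℝ => d.solutionPos q.1 q.2) (Ioi (0 : ℝ) ×ˢ univ) := by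
  have hw := d.continuous_w
  have hw₁ := d.continuous_w₁
  have hm := d.continuous_m
  have hm₁ := d.continuous_m₁
  have hc := continuous_cubic p
  have hc' := continuous_cubicDeriv p
  refine contDiffOn_one_of_partial_derivatives
    (fun t ht x => d.hasDerivAt_solutionPos_time hp ht x)
    (fun t ht x => d.hasDerivAt_solutionPos_space hp ht x) (fun t ht x => ?_) fun t ht x => ?_
  · refine ContinuousAt.add (Continuous.continuousAt (by fun_prop)) ?_
    exact (d.regularCoeffs hp).continuousAt_time
      (fun n t _ => (d.continuous_coeffDeriv n).continuousAt) ht x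
  · refine ContinuousAt.add (Continuous.continuousAt (by fun_prop)) ?_
    exact (d.regularCoeffs hp).continuousAt_space (fun n t _ => d.hasDerivAt_coeff n t) ht x

/-- The absolutely convergent series and the cubic are continuous with equal sine coefficients,
hence agree on `[0,1]`. This turns the forcing of the modes back into a pointwise term of the
equation. -/
theorem tsum_sineCoeff_cubic (hp : 0 < p) {x : ℝ} (hx : x ∈ Icc (0 : ℝ) 1) :
    HasSum (fun n => sineCoeff (cubic p) n * phi (n + 1) x) (cubic p x) := by
  have hb : ∀ n x, ‖sineCoeff (cubic p) n * phi (n + 1) x‖ ≤ 2 / p * 2 / ((n : ℝ) + 1) ^ 2 := by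
    intro n x
    rw [norm_mul, mul_div_right_comm]
    exact mul_le_mul (abs_sineCoeff_cubic_le hp n) (abs_phi_le _ _) (abs_nonneg _) (by positivity)
  have hs : Summable fun n => |sineCoeff (cubic p) n| :=
    .of_nonneg_of_le (fun _ => abs_nonneg _) (abs_sineCoeff_cubic_le hp)
      (summable_const_div_sq (2 / p))
  have hc : Continuous fun x => ∑' n, sineCoeff (cubic p) n * phi (n + 1) x :=
    continuous_tsum (fun n => continuous_const.mul (continuous_phi _)) (summable_const_div_sq _) hb
  have h := eqOn_Icc_of_sineCoeff_eq hc.continuousOn (continuous_cubic p).continuousOn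
    (fun n => sineCoeff_tsum hs n) hx
  have h2 : Summable fun n => sineCoeff (cubic p) n * phi (n + 1) x :=
    .of_norm_bounded (summable_const_div_sq _) fun n => hb n x
  simpa only [h] using h2.hasSum

/-- Since `p h'' = x`, the terms in `x` cancel exactly when `m = w₁ - θ w`; those in `cubic p x`
cancel against the series with factor `source = θ m - m₁`. -/
theorem solutionPos_pde (hp : 0 < p) {t : ℝ} (ht : 0 < t) {x : ℝ} (hx : x ∈ Icc (0 : ℝ) 1) :
    x * d.w₁ t + cubic p x * d.m₁ t + ∑' n, d.coeffDeriv n t * phi (n + 1) x =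
      p * (x / p * d.m t + ∑' n, d.coeff n t * (-waveNumber n ^ 2 * phi (n + 1) x)) +
        θ * d.solutionPos t x := by
  have hr := d.regularCoeffs hp
  have h1 := (((hr.summable_phi ht x).hasSum.mul_left θ).add
    ((hr.summable_phiDeriv2 ht x).hasSum.mul_left p)).add
    ((tsum_sineCoeff_cubic hp hx).mul_left (d.source t))
  have h2 : ∀ n, d.coeffDeriv n t * phi (n + 1) x = θ * (d.coeff n t * phi (n + 1) x) +
      p * (d.coeff n t * (-waveNumber n ^ 2 * phi (n + 1) x)) +
      d.source t * (sineCoeff (cubic p) n * phi (n + 1) x) := fun n => by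
    rw [coeffDeriv, eigenvalue_eq]
    ring
  rw [tsum_congr h2, h1.tsum_eq, solutionPos, source, m]
  field_simp
  ring

/-- The sine coefficients of the solution. -/
noncomputable def fullCoeff (n : ℕ) (t : ℝ) : ℝ :=
  d.w t * sineCoeff (fun x => x) n + d.m t * sineCoeff (cubic p) n + d.coeff n t

/-- The lifting terms recombine into the forcing by `w` because `boundaryCoeff p n` is `p
waveNumber²` times the sine coefficient of `x`. -/
theorem hasDerivAt_fullCoeff (hp : 0 < p) (n : ℕ) (t : ℝ) :
    HasDerivAt (d.fullCoeff n)
      (eigenvalue p θ n * d.fullCoeff n t + boundaryCoeff p n * d.w t) t := by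
  refine ((((d.hasDerivAt_w t).mul_const _).add ((d.hasDerivAt_m t).mul_const _)).add
    (d.hasDerivAt_coeff n t)).congr_deriv ?_
  rw [boundaryCoeff_eq, coeffDeriv, fullCoeff, sineCoeff_id_eq hp, eigenvalue_eq, source, m]
  ring

theorem fullCoeff_zero (n : ℕ) : d.fullCoeff n 0 = inner ℝ (mode n) u₀ := by
  rw [fullCoeff, coeff, modeCoeff_zero, initial, inner_sub_right, inner_sub_right,
    real_inner_smul_right, real_inner_smul_right, inner_mode_ofContinuous,
    inner_mode_ofContinuous]
  ring

/-- The consistency step: `w` was built from `y` before the solution existed. Both sides are driven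
by the same `w` and start from the same value, so their difference solves a homogeneous equation. -/
theorem fullCoeff_eq_y (hp : 0 < p) {t : ℝ} (ht : 0 ≤ t) (i : Fin N) :
    d.fullCoeff i t = d.y t i := by
  have hy : ∀ t, HasDerivAt (fun t => d.y t i) (generator p θ k (d.y t) i) t := fun t =>
    hasDerivAt_pi.1 (d.hasDerivAt_y t) i
  have hd : ∀ t, HasDerivAt (fun t => d.fullCoeff i t - d.y t i)
      (eigenvalue p θ i * (d.fullCoeff i t - d.y t i)) t := fun t =>
    ((d.hasDerivAt_fullCoeff hp i t).sub (hy t)).congr_deriv (by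
      rw [generator_apply, d.w_eq]; ring)
  have := norm_le_mul_exp_of_hasDerivAt (K := |eigenvalue p θ i|)
    (fun t _ => (hd t).continuousAt.continuousWithinAt) (fun t _ => hd t)
    (fun t _ => (abs_mul _ _).le) ht
  rw [d.fullCoeff_zero, d.y_zero, sub_self, norm_zero, zero_mul] at this
  exact sub_eq_zero.1 (norm_le_zero_iff.1 this)

theorem sineCoeff_solutionPos (hp : 0 < p) {t : ℝ} (ht : 0 < t) (n : ℕ) :
    sineCoeff (d.solutionPos t) n = d.fullCoeff n t := by
  have hr := d.regularCoeffs hp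
  have hphi := continuous_phi (n + 1)
  have hcub := continuous_cubic p
  have hser : Continuous fun x => ∑' n, d.coeff n t * phi (n + 1) x :=
    continuous_iff_continuousAt.2 fun x => (hr.hasDerivAt_space ht x).continuousAt
  have h1 : ∀ x, phi (n + 1) x * d.solutionPos t x =
      d.w t * (phi (n + 1) x * x) + d.m t * (phi (n + 1) x * cubic p x) +
        phi (n + 1) x * ∑' n, d.coeff n t * phi (n + 1) x := by
    intro x
    rw [solutionPos]
    ring
  have h2 := sineCoeff_tsum (hr.summable_abs ht) n
  unfold sineCoeff at h2
  simp only [sineCoeff, fullCoeff, h1]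
  rw [intervalIntegral.integral_add, intervalIntegral.integral_add,
    intervalIntegral.integral_const_mul, intervalIntegral.integral_const_mul, h2]
  all_goals exact Continuous.intervalIntegrable (by fun_prop) _ _

theorem summable_sq_sineCoeff_cubic : Summable fun n => sineCoeff (cubic p) n ^ 2 := by
  have := (hasSum_sq_inner_mode (ofContinuous (continuous_cubic p))).summable
  simpa only [inner_mode_ofContinuous] using this

theorem exists_series_curve (hp : 0 < p) : ∃ V : ℝ → L2, ContinuousOn V (Ici 0) ∧
    ∀ t, 0 ≤ t → ∀ n, inner ℝ (mode n) (V t) = d.coeff n t := by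
  refine exists_continuousOn_curve d.continuous_coeff fun T => ?_
  obtain ⟨K, hK⟩ := isCompact_Icc.exists_bound_of_continuousOn
    (d.continuous_source.continuousOn (s := Icc 0 T))
  refine ⟨fun n => 2 * Real.exp (|θ| * T) ^ 2 * (inner ℝ (mode n) d.initial ^ 2 +
    (K / p) ^ 2 * sineCoeff (cubic p) n ^ 2), ?_, fun n t ht => ?_⟩
  · exact ((hasSum_sq_inner_mode d.initial).summable.add
      (summable_sq_sineCoeff_cubic.mul_left _)).mul_left _
  · refine (sq_modeCoeff_le hp θ _ _ n ht.1 fun s hs => hK s ⟨hs.1, hs.2.trans ht.2⟩).trans ?_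
    have := ht.2
    beta_reduce
    gcongr

theorem norm_series_curve_le (hp : 0 < p) {f : L2} {t K : ℝ} (ht : 0 ≤ t)
    (hf : ∀ n, inner ℝ (mode n) f = d.coeff n t) (hK : ∀ s ∈ Icc 0 t, |d.source s| ≤ K) :
    ‖f‖ ≤ 2 * Real.exp (|θ| * t) *
      (‖d.initial‖ + K / p * ‖ofContinuous (continuous_cubic p)‖) := by
  have hK0 : 0 ≤ K := (abs_nonneg _).trans (hK 0 ⟨le_rfl, ht⟩)
  have h1 := hasSum_sq_inner_mode f
  have h2 := hasSum_sq_inner_mode (ofContinuous (continuous_cubic p))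
  simp only [hf] at h1
  simp only [inner_mode_ofContinuous] at h2
  have h3 := hasSum_le (fun n => sq_modeCoeff_le hp θ _ _ n ht hK) h1
    (((hasSum_sq_inner_mode d.initial).add (h2.mul_left ((K / p) ^ 2))).mul_left
      (2 * Real.exp (|θ| * t) ^ 2))
  refine le_of_sq_le_sq (h3.trans ?_) (by positivity)
  have h4 : 0 ≤ ‖d.initial‖ * (K / p * ‖ofContinuous (continuous_cubic p)‖) := by positivity
  have h5 : 0 ≤ Real.exp (|θ| * t) ^ 2 := by positivity
  have h6 : ‖d.initial‖ ^ 2 + (K / p) ^ 2 * ‖ofContinuous (continuous_cubic p)‖ ^ 2 ≤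
      (‖d.initial‖ + K / p * ‖ofContinuous (continuous_cubic p)‖) ^ 2 := by nlinarith
  -- The factor `2` is relaxed to `4` to make the bound a perfect square.
  calc 2 * Real.exp (|θ| * t) ^ 2 *
        (‖d.initial‖ ^ 2 + (K / p) ^ 2 * ‖ofContinuous (continuous_cubic p)‖ ^ 2)
      ≤ 4 * Real.exp (|θ| * t) ^ 2 *
        (‖d.initial‖ + K / p * ‖ofContinuous (continuous_cubic p)‖) ^ 2 := by
        gcongr
        norm_num
    _ = _ := by ring

/-- Both sides have sine coefficients `fullCoeff`. At `t = 0` these are the coefficients of `u₀`,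
because the lifting was subtracted in `initial`. -/
theorem solution_ae_eq (hp : 0 < p) {t : ℝ} (ht : 0 ≤ t) {f : L2}
    (hf : ∀ n, inner ℝ (mode n) f = d.coeff n t) :
    d.solution t =ᵐ[volume.restrict (Ioo (0 : ℝ) 1)]
      (d.w t • ofContinuous continuous_id' + d.m t • ofContinuous (continuous_cubic p) + f : L2) := by
  have hin : ∀ n, inner ℝ (mode n)
      (d.w t • ofContinuous continuous_id' + d.m t • ofContinuous (continuous_cubic p) + f : L2) =
      d.fullCoeff n t := by
    intro n
    rw [inner_add_right, inner_add_right, real_inner_smul_right, real_inner_smul_right,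
      inner_mode_ofContinuous, inner_mode_ofContinuous, hf, fullCoeff]
  rcases ht.eq_or_lt with rfl | ht
  · have he := ext_inner_mode (g := u₀) fun n => (hin n).trans (d.fullCoeff_zero n)
    rw [he]
    exact .of_eq (by ext x; simp [solution])
  · have hc := (d.contDiff_solutionPos hp ht).continuous
    have he := ext_inner_mode (g := ofContinuous hc) fun n => (hin n).trans <| by
      rw [inner_mode_ofContinuous, d.sineCoeff_solutionPos hp ht]
    rw [he, d.solution_of_pos ht]
    exact (coeFn_ofContinuous hc).symm

theorem isSolution_solution (hp : 0 < p) : IsSolution p θ (kernel k) u₀ d.solution where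
  curve := by
    obtain ⟨V, hV, hVn⟩ := d.exists_series_curve hp
    refine ⟨fun t => d.w t • ofContinuous continuous_id' +
      d.m t • ofContinuous (continuous_cubic p) + V t, ?_, ?_, fun t ht =>
        d.solution_ae_eq hp ht (hVn t ht)⟩
    · have hw := d.continuous_w
      have hm := d.continuous_m
      exact (Continuous.continuousOn (by fun_prop)).add hV
    · refine ext_inner_mode fun n => ?_
      rw [inner_add_right, inner_add_right, real_inner_smul_right, real_inner_smul_right,
        inner_mode_ofContinuous, inner_mode_ofContinuous, hVn 0 le_rfl, ← d.fullCoeff_zero,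
        fullCoeff]
  contDiffOn_one :=
    ((d.contDiffOn_one_solutionPos hp).mono (prod_mono le_rfl (subset_univ _))).congr
      fun q hq => by rw [d.solution_of_pos hq.1]
  contDiffOn_two t ht := by
    rw [d.solution_of_pos ht]
    exact (d.contDiff_solutionPos hp ht).contDiffOn
  pde t ht x hx := by
    have h1 : (fun s => d.solution s x) =ᶠ[nhds t] fun s => d.solutionPos s x := by
      filter_upwards [Ioi_mem_nhds ht] with s hs
      rw [d.solution_of_pos hs]
    rw [h1.deriv_eq, (d.hasDerivAt_solutionPos_time hp ht x).deriv, d.solution_of_pos ht,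
      iteratedDeriv_two_eq (d.hasDerivAt_solutionPos_space hp ht)
        (d.hasDerivAt_solutionPos_space2 hp ht), d.solutionPos_pde hp ht (Ioo_subset_Icc_self hx)]
  left_bc t ht := by
    rw [d.solution_of_pos ht]
    simp [solutionPos, cubic, phi_zero_right]
  right_bc t ht := by
    rw [d.solution_of_pos ht, integral_kernel_mul k
      ((d.contDiff_solutionPos hp ht).continuous.intervalIntegrable _ _)]
    simp only [d.sineCoeff_solutionPos hp ht, d.fullCoeff_eq_y hp ht.le]
    simp [solutionPos, cubic, phi_one_right, d.w_eq]

theorem l2Norm_solution_le (hp : 0 < p) {C a : ℝ} (hC : 0 ≤ C) (ha : 0 ≤ a)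
    (hb : ∀ t, 0 ≤ t → |d.w t| ≤ C * ‖u₀‖ * Real.exp (a * t) ∧
      |d.w₁ t| ≤ C * ‖u₀‖ * Real.exp (a * t) ∧ |d.w₂ t| ≤ C * ‖u₀‖ * Real.exp (a * t))
    {t : ℝ} (ht : 0 ≤ t) :
    l2Norm (d.solution t) ≤
      (C * ‖ofContinuous continuous_id'‖ +
        (1 + |θ|) * C * ‖ofContinuous (continuous_cubic p)‖ +
        2 * (1 + C * ‖ofContinuous continuous_id'‖ +
          (1 + |θ|) * C * ‖ofContinuous (continuous_cubic p)‖ +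
          (1 + |θ|) ^ 2 * C / p * ‖ofContinuous (continuous_cubic p)‖)) *
      Real.exp ((a + |θ|) * t) * ‖u₀‖ := by
  obtain ⟨V, -, hVn⟩ := d.exists_series_curve hp
  set X : L2 := ofContinuous continuous_id' with hX
  set H : L2 := ofContinuous (continuous_cubic p) with hH
  have hm : ∀ s, 0 ≤ s → |d.m s| ≤ (1 + |θ|) * C * ‖u₀‖ * Real.exp (a * s) := by
    intro s hs
    obtain ⟨h0, h1, -⟩ := hb s hs
    calc |d.m s| ≤ |d.w₁ s| + |θ| * |d.w s| := by
          rw [m, ← abs_mul]; exact abs_sub _ _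
      _ ≤ C * ‖u₀‖ * Real.exp (a * s) + |θ| * (C * ‖u₀‖ * Real.exp (a * s)) := by gcongr
      _ = _ := by ring
  have hm₁ : ∀ s, 0 ≤ s → |d.m₁ s| ≤ (1 + |θ|) * C * ‖u₀‖ * Real.exp (a * s) := by
    intro s hs
    obtain ⟨-, h0, h1⟩ := hb s hs
    calc |d.m₁ s| ≤ |d.w₂ s| + |θ| * |d.w₁ s| := by
          rw [m₁, ← abs_mul]; exact abs_sub _ _
      _ ≤ C * ‖u₀‖ * Real.exp (a * s) + |θ| * (C * ‖u₀‖ * Real.exp (a * s)) := by gcongr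
      _ = _ := by ring
  have hG : ∀ s ∈ Icc 0 t, |d.source s| ≤ (1 + |θ|) ^ 2 * C * ‖u₀‖ * Real.exp (a * t) := by
    intro s hs
    have h0 := hm s hs.1
    have h1 := hm₁ s hs.1
    have hst := hs.2
    calc |d.source s| ≤ |θ| * |d.m s| + |d.m₁ s| := by
          rw [source, ← abs_mul]; exact abs_sub _ _
      _ ≤ |θ| * ((1 + |θ|) * C * ‖u₀‖ * Real.exp (a * s)) +
          (1 + |θ|) * C * ‖u₀‖ * Real.exp (a * s) := by gcongr
      _ = (1 + |θ|) ^ 2 * C * ‖u₀‖ * Real.exp (a * s) := by ring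
      _ ≤ _ := by gcongr
  have hinit : ‖d.initial‖ ≤ (1 + C * ‖X‖ + (1 + |θ|) * C * ‖H‖) * ‖u₀‖ := by
    have h0 := (hb 0 le_rfl).1
    have h1 := hm 0 le_rfl
    rw [mul_zero, Real.exp_zero, mul_one] at h0 h1
    calc ‖d.initial‖ ≤ ‖u₀‖ + |d.w 0| * ‖X‖ + |d.m 0| * ‖H‖ := by
          refine (norm_sub_le _ _).trans (add_le_add ((norm_sub_le _ _).trans
            (add_le_add le_rfl ?_)) ?_)
          · rw [norm_smul, Real.norm_eq_abs]
          · rw [norm_smul, Real.norm_eq_abs]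
      _ ≤ ‖u₀‖ + C * ‖u₀‖ * ‖X‖ + (1 + |θ|) * C * ‖u₀‖ * ‖H‖ := by gcongr
      _ = _ := by ring
  have hV := d.norm_series_curve_le hp ht (hVn t ht) hG
  rw [l2Norm_congr (d.solution_ae_eq hp ht (hVn t ht)), l2Norm_coeFn]
  have e1 : Real.exp ((a + |θ|) * t) = Real.exp (|θ| * t) * Real.exp (a * t) := by
    rw [← Real.exp_add]; ring_nf
  have e2 : 1 ≤ Real.exp (|θ| * t) := Real.one_le_exp (by positivity)
  have e3 : 1 ≤ Real.exp (a * t) := Real.one_le_exp (by positivity)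
  calc ‖d.w t • X + d.m t • H + V t‖ ≤ |d.w t| * ‖X‖ + |d.m t| * ‖H‖ + ‖V t‖ := by
        refine (norm_add_le _ _).trans (add_le_add ((norm_add_le _ _).trans ?_) le_rfl)
        rw [norm_smul, norm_smul, Real.norm_eq_abs, Real.norm_eq_abs]
    _ ≤ C * ‖u₀‖ * (Real.exp (|θ| * t) * Real.exp (a * t)) * ‖X‖ +
        (1 + |θ|) * C * ‖u₀‖ * (Real.exp (|θ| * t) * Real.exp (a * t)) * ‖H‖ +
        2 * Real.exp (|θ| * t) * ((1 + C * ‖X‖ + (1 + |θ|) * C * ‖H‖) * ‖u₀‖ * Real.exp (a * t) +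
          (1 + |θ|) ^ 2 * C * ‖u₀‖ * Real.exp (a * t) / p * ‖H‖) := by
        have e4 : Real.exp (a * t) ≤ Real.exp (|θ| * t) * Real.exp (a * t) :=
          le_mul_of_one_le_left (Real.exp_pos _).le e2
        have h1 : |d.w t| ≤ C * ‖u₀‖ * (Real.exp (|θ| * t) * Real.exp (a * t)) :=
          (hb t ht).1.trans (by gcongr)
        have h2 : |d.m t| ≤ (1 + |θ|) * C * ‖u₀‖ * (Real.exp (|θ| * t) * Real.exp (a * t)) :=
          (hm t ht).trans (by gcongr)
        have h3 : ‖d.initial‖ ≤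
            (1 + C * ‖X‖ + (1 + |θ|) * C * ‖H‖) * ‖u₀‖ * Real.exp (a * t) :=
          hinit.trans (le_mul_of_one_le_right (by positivity) e3)
        refine add_le_add (by gcongr) (hV.trans (by gcongr))
    _ = _ := by rw [e1]; ring

end BoundaryData

end ReactionDiffusion

theorem corollary5p6 (p θ : ℝ) (hp : 0 < p) (N : ℕ) (hN : 1 ≤ N) (k : Fin N → ℝ) :
    ∃ Q σ : ℝ, 0 < Q ∧ 0 < σ ∧
      ∀ u₀ : ReactionDiffusion.L2,
        ∃ u : ℝ → ℝ → ℝ,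
          ReactionDiffusion.IsSolution p θ (ReactionDiffusion.kernel k) u₀ u ∧
          (∀ t, 0 ≤ t → ReactionDiffusion.l2Norm (u t)
              ≤ Q * Real.exp (σ * t) * ReactionDiffusion.l2Norm u₀) ∧
          ∀ v : ℝ → ℝ → ℝ,
            ReactionDiffusion.IsSolution p θ (ReactionDiffusion.kernel k) u₀ v →
            v 0 =ᵐ[volume.restrict (Ioo (0 : ℝ) 1)] u 0 ∧
            ∀ t, 0 < t → ∀ x ∈ Icc (0 : ℝ) 1, v t x = u t x := by
  open ReactionDiffusion in
  obtain ⟨C, a, hC, ha, hd⟩ := exists_boundaryData p θ k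
  have hQ : 0 < C * ‖ofContinuous continuous_id'‖ +
        (1 + |θ|) * C * ‖ofContinuous (continuous_cubic p)‖ +
        2 * (1 + C * ‖ofContinuous continuous_id'‖ +
          (1 + |θ|) * C * ‖ofContinuous (continuous_cubic p)‖ +
          (1 + |θ|) ^ 2 * C / p * ‖ofContinuous (continuous_cubic p)‖) := by positivity
  -- The estimate holds with rate `a + |θ|`, which may be zero; adding `1` makes `σ` positive.
  refine ⟨_, a + |θ| + 1, hQ, by positivity, fun u₀ => ?_⟩
  obtain ⟨d, hb⟩ := hd u₀
  have hsol := d.isSolution_solution hp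
  refine ⟨d.solution, hsol, fun t ht => ?_, fun v hv =>
    ⟨hv.coeFn_zero.trans hsol.coeFn_zero.symm, fun t ht => hv.eqOn hsol ht⟩⟩
  refine (d.l2Norm_solution_le hp hC ha hb ht).trans ?_
  rw [l2Norm_coeFn]
  have hexp : Real.exp ((a + |θ|) * t) ≤ Real.exp ((a + |θ| + 1) * t) :=
    Real.exp_le_exp.2 (mul_le_mul_of_nonneg_right (by linarith) ht)
  gcongr
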